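/- Theorem 3.1. Let $H^1(\mathbb R^2)$ be the space of (complex-valued) locally integrable functions $F$ on $\mathbb R^2$ whose distributional gradient is in $L^2$, modulo constants, with norm $\|F\|_{H^1}^2=\int_{\mathbb R^2}|\nabla F|^2\,dx\,dy$, and let $H^{1/2}(\mathbb R)$ be the space of locally $L^2$ functions $f$ on $\mathbb R$, modulo constants, with $$\|f\|_{H^{1/2}}^2=\int_{\mathbb R}\int_{\mathbb R}\frac{|f(x)-f(y)|^2}{|x-y|^2}\,dx\,dy<\infty .$$ A measurable function $f$ on $\mathbb R$ is called the trace of $F$ on the line $y=0$ if for every $R>0$ one has $\int_{-R}^{R}|F(x,y)-f(x)|^2\,dx\to 0$ as $y\to 0$ outside a set of measure zero. There is an absolute constant $c>0$ such that the following hold. (a) Every function $F$ of finite energy has a trace $TF$ on the line $y=0$, unique up to null sets, which is locally $L^2$ with finite $H^{1/2}$ norm; if $F$ is continuous, then $TF(x)=F(x,0)$. The induced map $T:H^1(\mathbb R^2)\to H^{1/2}(\mathbb R)$ is linear and continuous, with $\|TF\|_{H^{1/2}}\le c\,\|F\|_{H^1}$. (b) For every locally $L^2$ function $f$ with finite $H^{1/2}$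 norm, the Poisson integral $$Ef(x,y)=\frac{|y|}{\pi}\int_{\mathbb R}\frac{f(x-t)}{t^2+y^2}\,dt\qquad(y\ne 0)$$ converges absolutely, and $Ef$ has finite energy and trace $f$. The induced map $E:H^{1/2}(\mathbb R)\to H^1(\mathbb R^2)$ is linear and continuous, with $TEf=f$ and $\|Ef\|_{H^1}\le c\,\|f\|_{H^{1/2}}$. -/

import Mathlib

open MeasureTheory Filter Topology Set
open scoped ContDiff ENNReal

noncomputable section

/-! ### Functions of finite energy on the plane -/

/-- The Hilbert space `L²(ℝ²) × L²(ℝ²)` of square integrable (complex) vector fields on the plane,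
with `‖(G₁, G₂)‖² = ‖G₁‖² + ‖G₂‖²`. -/
abbrev L2Field : Type :=
  WithLp 2 (Lp ℂ 2 (volume : Measure (ℝ × ℝ)) × Lp ℂ 2 (volume : Measure (ℝ × ℝ)))

/-- `g` is the derivative of `F` in the direction `v` in the distribution sense. -/
def IsWeakDeriv (v : ℝ × ℝ) (F g : ℝ × ℝ → ℂ) : Prop :=
  ∀ φ : ℝ × ℝ → ℝ, ContDiff ℝ ∞ φ → HasCompactSupport φ →
    ∫ p, (fderiv ℝ φ p v) • F p = -∫ p, φ p • g p

theorem L2_integrable_sq (g : Lp ℂ 2 (volume : Measure (ℝ × ℝ))) :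
    Integrable (fun p => ‖g p‖ ^ 2) :=
  (Lp.memLp g).integrable_norm_pow (by norm_num)

theorem L2_norm_sq (g : Lp ℂ 2 (volume : Measure (ℝ × ℝ))) : ‖g‖ ^ 2 = ∫ p, ‖g p‖ ^ 2 := by
  have h := L2.inner_def (𝕜 := ℂ) g g
  simp only [inner_self_eq_norm_sq_to_K] at h
  have h2 : ((‖g‖ ^ 2 : ℝ) : ℂ) = ((∫ p, ‖g p‖ ^ 2 : ℝ) : ℂ) := by
    rw [← integral_complex_ofReal]
    simpa using h
  exact_mod_cast h2

/-- `G` is the gradient of `F` in the distribution sense. -/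
def IsWeakGrad (F : ℝ × ℝ → ℂ) (G : L2Field) : Prop :=
  IsWeakDeriv (1, 0) F G.fst ∧ IsWeakDeriv (0, 1) F G.snd

theorem integrable_test_smul {F : ℝ × ℝ → ℂ} (hF : LocallyIntegrable F) {φ : ℝ × ℝ → ℝ}
    (h1 : Continuous φ) (h2 : HasCompactSupport φ) : Integrable (fun p => φ p • F p) :=
  hF.integrable_smul_left_of_hasCompactSupport h1 h2

theorem integrable_deriv_smul {F : ℝ × ℝ → ℂ} (hF : LocallyIntegrable F) {φ : ℝ × ℝ → ℝ}
    (h1 : ContDiff ℝ ∞ φ) (h2 : HasCompactSupport φ) (v : ℝ × ℝ) :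
    Integrable (fun p => (fderiv ℝ φ p v) • F p) := by
  refine integrable_test_smul hF (φ := fun p => fderiv ℝ φ p v) ?_ (h2.fderiv_apply ℝ v)
  exact (h1.continuous_fderiv (by simp)).clm_apply continuous_const

theorem L2_locallyIntegrable (g : Lp ℂ 2 (volume : Measure (ℝ × ℝ))) :
    LocallyIntegrable (g : ℝ × ℝ → ℂ) :=
  (Lp.memLp g).locallyIntegrable (by norm_num)

theorem IsWeakDeriv.add {v : ℝ × ℝ} {F F' : ℝ × ℝ → ℂ} (hF : LocallyIntegrable F)
    (hF' : LocallyIntegrable F') {g g' : Lp ℂ 2 (volume : Measure (ℝ × ℝ))}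
    (h : IsWeakDeriv v F g) (h' : IsWeakDeriv v F' g') :
    IsWeakDeriv v (F + F') (g + g' : Lp ℂ 2 (volume : Measure (ℝ × ℝ))) := by
  intro φ h1 h2
  have e : ∫ p, φ p • (g + g' : Lp ℂ 2 (volume : Measure (ℝ × ℝ))) p
      = ∫ p, (φ p • g p + φ p • g' p) := by
    refine integral_congr_ae ?_
    filter_upwards [Lp.coeFn_add g g'] with p hp
    rw [hp, Pi.add_apply, smul_add]
  rw [e, integral_add (integrable_test_smul (L2_locallyIntegrable g) h1.continuous h2)
    (integrable_test_smul (L2_locallyIntegrable g') h1.continuous h2)]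
  simp only [Pi.add_apply, smul_add]
  rw [integral_add (integrable_deriv_smul hF h1 h2 v) (integrable_deriv_smul hF' h1 h2 v),
    h φ h1 h2, h' φ h1 h2, neg_add]

theorem IsWeakDeriv.const_smul {v : ℝ × ℝ} {F : ℝ × ℝ → ℂ}
    {g : Lp ℂ 2 (volume : Measure (ℝ × ℝ))} (h : IsWeakDeriv v F g) (a : ℂ) :
    IsWeakDeriv v (a • F) (a • g : Lp ℂ 2 (volume : Measure (ℝ × ℝ))) := by
  intro φ h1 h2
  have e : ∫ p, φ p • (a • g : Lp ℂ 2 (volume : Measure (ℝ × ℝ))) p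
      = ∫ p, a • (φ p • g p) := by
    refine integral_congr_ae ?_
    filter_upwards [Lp.coeFn_smul a g] with p hp
    rw [hp, Pi.smul_apply, smul_comm]
  rw [e, integral_smul]
  have e' : ∀ p, (fderiv ℝ φ p v) • (a • F) p = a • ((fderiv ℝ φ p v) • F p) := fun p => by
    rw [Pi.smul_apply, smul_comm]
  simp only [e']
  rw [integral_smul, h φ h1 h2, smul_neg]

theorem IsWeakDeriv.unique {v : ℝ × ℝ} {F : ℝ × ℝ → ℂ}
    {g g' : Lp ℂ 2 (volume : Measure (ℝ × ℝ))} (h : IsWeakDeriv v F g)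
    (h' : IsWeakDeriv v F g') : g = g' := by
  refine Lp.ext (ae_eq_of_integral_contDiff_smul_eq (L2_locallyIntegrable g)
    (L2_locallyIntegrable g') fun φ h1 h2 => ?_)
  exact neg_injective ((h φ h1 h2).symm.trans (h' φ h1 h2))

theorem IsWeakGrad.unique {F : ℝ × ℝ → ℂ} {G G' : L2Field} (h : IsWeakGrad F G)
    (h' : IsWeakGrad F G') : G = G' :=
  (WithLp.equiv 2 _).injective (Prod.ext (h.1.unique h'.1) (h.2.unique h'.2))

/-- The complex vector space of functions of finite energy on the plane: the locally integrable
functions whose gradient in the distribution sense is in `L²`. -/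
def energyFunctions : Submodule ℂ (ℝ × ℝ → ℂ) where
  carrier := {F | LocallyIntegrable F ∧ ∃ G : L2Field, IsWeakGrad F G}
  zero_mem' := by
    refine ⟨locallyIntegrable_zero, 0, ?_, ?_⟩ <;>
    · intro φ _ _
      have : ∫ p, φ p • (0 : Lp ℂ 2 (volume : Measure (ℝ × ℝ))) p = 0 := by
        refine integral_eq_zero_of_ae ?_
        filter_upwards [Lp.coeFn_zero ℂ 2 (volume : Measure (ℝ × ℝ))] with p _
        simp
      simp
  add_mem' := by
    rintro F F' ⟨hF, G, hG⟩ ⟨hF', G', hG'⟩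
    exact ⟨hF.add hF', G + G', hG.1.add hF hF' hG'.1, hG.2.add hF hF' hG'.2⟩
  smul_mem' := by
    rintro a F ⟨hF, G, hG⟩
    exact ⟨hF.smul a, a • G, hG.1.const_smul a, hG.2.const_smul a⟩

/-- The gradient (in the distribution sense) of a function of finite energy. -/
def weakGrad : energyFunctions →ₗ[ℂ] L2Field where
  toFun F := F.2.2.choose
  map_add' F F' := by
    have h := F.2.2.choose_spec
    have h' := F'.2.2.choose_spec
    exact (F + F').2.2.choose_spec.unique
      ⟨h.1.add F.2.1 F'.2.1 h'.1, h.2.add F.2.1 F'.2.1 h'.2⟩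
  map_smul' a F := by
    have h := F.2.2.choose_spec
    exact (a • F).2.2.choose_spec.unique ⟨h.1.const_smul a, h.2.const_smul a⟩

theorem isWeakGrad_weakGrad (F : energyFunctions) : IsWeakGrad F (weakGrad F) :=
  F.2.2.choose_spec

/-- The functions of finite energy that are (almost everywhere equal to) constants. -/
def energyConstants : Submodule ℂ energyFunctions where
  carrier := {F | ∃ c : ℂ, (F : ℝ × ℝ → ℂ) =ᵐ[volume] fun _ => c}
  zero_mem' := ⟨0, by rfl⟩
  add_mem' := by
    rintro F F' ⟨c, hc⟩ ⟨c', hc'⟩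
    exact ⟨c + c', hc.add hc'⟩
  smul_mem' := by
    rintro a F ⟨c, hc⟩
    exact ⟨a • c, hc.const_smul a⟩

theorem isWeakDeriv_const {v : ℝ × ℝ} {F : ℝ × ℝ → ℂ} {c : ℂ} (h : F =ᵐ[volume] fun _ => c) :
    IsWeakDeriv v F (0 : Lp ℂ 2 (volume : Measure (ℝ × ℝ))) := by
  intro φ h1 h2
  have e : ∫ p, φ p • (0 : Lp ℂ 2 (volume : Measure (ℝ × ℝ))) p = 0 := by
    refine integral_eq_zero_of_ae ?_
    filter_upwards [Lp.coeFn_zero ℂ 2 (volume : Measure (ℝ × ℝ))] with p _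
    simp
  have e' : ∫ p, (fderiv ℝ φ p v) • F p = ∫ p, (fderiv ℝ φ p v) • c := by
    refine integral_congr_ae ?_
    filter_upwards [h] with p hp
    rw [hp]
  have hc : LocallyIntegrable (fun _ : ℝ × ℝ => (1 : ℝ)) := locallyIntegrable_const 1
  have i1 : Integrable (fun p => fderiv ℝ φ p v) :=
    ((h1.continuous_fderiv (by simp)).clm_apply continuous_const).integrable_of_hasCompactSupport
      (h2.fderiv_apply ℝ v)
  have i2 : Integrable φ := h1.continuous.integrable_of_hasCompactSupport h2
  have key := integral_mul_fderiv_eq_neg_fderiv_mul_of_integrable (μ := volume) (v := v)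
    (f := fun _ : ℝ × ℝ => (1 : ℝ)) (g := φ) (by simp) (by simpa using i1) (by simpa using i2)
    (fun _ _ => differentiableAt_const _) (fun p _ => h1.differentiable (by simp) p)
  rw [e, e', integral_smul_const, neg_zero]
  simp only [one_mul, fderiv_fun_const, Pi.zero_apply, zero_apply, zero_mul,
    integral_zero, neg_zero] at key
  rw [key, zero_smul]

theorem energyConstants_le_ker : energyConstants ≤ LinearMap.ker weakGrad := by
  rintro F ⟨c, hc⟩
  have h : IsWeakGrad F 0 := ⟨isWeakDeriv_const hc, isWeakDeriv_const hc⟩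
  exact (isWeakGrad_weakGrad F).unique h

theorem ae_const_of_weakDeriv_zero {F : ℝ × ℝ → ℂ} (hF : LocallyIntegrable F)
    (h : ∀ (v : ℝ × ℝ) (φ : ℝ × ℝ → ℝ), ContDiff ℝ ∞ φ → HasCompactSupport φ →
      ∫ p, (fderiv ℝ φ p v) • F p = 0) : ∃ c : ℂ, F =ᵐ[volume] fun _ => c := by
  let L : ℂ →L[ℝ] ℝ →L[ℝ] ℂ := (ContinuousLinearMap.lsmul ℝ ℝ).flip
  have key : ∀ ρ : ℝ × ℝ → ℝ, ContDiff ℝ ∞ ρ → HasCompactSupport ρ →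
      ∀ x y, convolution F ρ L volume x = convolution F ρ L volume y := by
    intro ρ h1 h2
    have hd : ∀ x, HasFDerivAt (convolution F ρ L volume)
        (0 : ℝ × ℝ →L[ℝ] ℂ) x := by
      intro x
      have := h2.hasFDerivAt_convolution_right L hF (h1.of_le (by simp)) x
      suffices e0 : (convolution F (fderiv ℝ ρ) (L.precompR (ℝ × ℝ)) volume x) = 0 by
        rw [e0] at this; exact this
      refine ContinuousLinearMap.ext fun v => ?_
      rw [convolution_precompR_apply L hF (h2.fderiv ℝ) (h1.continuous_fderiv (by simp)),
        convolution_def]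
      have hφ1 : ContDiff ℝ ∞ (fun t => ρ (x - t)) := h1.comp (contDiff_const.sub contDiff_id)
      have hφ2 : HasCompactSupport (fun t => ρ (x - t)) :=
        h2.comp_homeomorph (Homeomorph.subLeft x)
      have := h v _ hφ1 hφ2
      have e : ∀ t, fderiv ℝ (fun t => ρ (x - t)) t v = -(fderiv ℝ ρ (x - t) v) := by
        intro t
        have a : HasFDerivAt (fun t => x - t) (-ContinuousLinearMap.id ℝ (ℝ × ℝ)) t := by
          simpa using (hasFDerivAt_id t).const_sub x
        have b := ((h1.differentiable (by simp) (x - t)).hasFDerivAt).comp t a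
        have b' := b.fderiv
        simp only [Function.comp_def] at b'
        rw [b']
        simp
      simp only [e, neg_smul, integral_neg, neg_eq_zero] at this
      simpa [L] using this
    exact fun x y => is_const_of_fderiv_eq_zero (fun x => (hd x).differentiableAt)
      (fun x => (hd x).fderiv) x y
  let φ : ℕ → ContDiffBump (0 : ℝ × ℝ) := fun n =>
    ⟨1 / ((n : ℝ) + 1), 2 * (1 / ((n : ℝ) + 1)), by positivity, by
      have : 0 < 1 / ((n : ℝ) + 1) := by positivity
      linarith⟩
  have hlim := ContDiffBump.ae_convolution_tendsto_right_of_locallyIntegrable (μ := volume)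
    (φ := φ) (l := atTop) (K := 2)
    (by simpa [φ] using (tendsto_one_div_add_atTop_nhds_zero_nat (𝕜 := ℝ)).const_mul 2)
    (Eventually.of_forall fun n => le_rfl) hF
  have hc : ∀ n x y, convolution ((φ n).normed volume) F (ContinuousLinearMap.lsmul ℝ ℝ) volume x
      = convolution ((φ n).normed volume) F (ContinuousLinearMap.lsmul ℝ ℝ) volume y := by
    intro n x y
    have := key ((φ n).normed volume) (φ n).contDiff_normed (φ n).hasCompactSupport_normed x y
    simpa only [L, convolution_flip] using this
  obtain ⟨x₀, hx₀⟩ := hlim.exists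
  refine ⟨F x₀, ?_⟩
  filter_upwards [hlim] with x hx
  refine tendsto_nhds_unique hx ?_
  simpa only [hc _ x x₀] using hx₀

theorem ker_weakGrad_le : LinearMap.ker weakGrad ≤ energyConstants := by
  intro F hF
  have hG := isWeakGrad_weakGrad F
  rw [LinearMap.mem_ker.1 hF] at hG
  refine ae_const_of_weakDeriv_zero F.2.1 fun v φ h1 h2 => ?_
  have e : ∫ p, φ p • (0 : Lp ℂ 2 (volume : Measure (ℝ × ℝ))) p = 0 := by
    refine integral_eq_zero_of_ae ?_
    filter_upwards [Lp.coeFn_zero ℂ 2 (volume : Measure (ℝ × ℝ))] with p _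
    simp
  have d1 : ∫ p, (fderiv ℝ φ p (1, 0)) • (F : ℝ × ℝ → ℂ) p = 0 := by
    rw [hG.1 φ h1 h2]; exact neg_eq_zero.2 e
  have d2 : ∫ p, (fderiv ℝ φ p (0, 1)) • (F : ℝ × ℝ → ℂ) p = 0 := by
    rw [hG.2 φ h1 h2]; exact neg_eq_zero.2 e
  have hv : v = v.1 • ((1, 0) : ℝ × ℝ) + v.2 • ((0, 1) : ℝ × ℝ) := by ext <;> simp
  have e3 : ∀ p, (fderiv ℝ φ p v) • (F : ℝ × ℝ → ℂ) p
      = v.1 • ((fderiv ℝ φ p (1, 0)) • (F : ℝ × ℝ → ℂ) p)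
        + v.2 • ((fderiv ℝ φ p (0, 1)) • (F : ℝ × ℝ → ℂ) p) := by
    intro p
    conv_lhs => rw [hv, map_add, map_smul, map_smul, add_smul, smul_assoc, smul_assoc]
  simp only [e3]
  rw [integral_add (f := fun p => v.1 • ((fderiv ℝ φ p (1, 0)) • (F : ℝ × ℝ → ℂ) p))
    (g := fun p => v.2 • ((fderiv ℝ φ p (0, 1)) • (F : ℝ × ℝ → ℂ) p))
    ((integrable_deriv_smul F.2.1 h1 h2 _).smul v.1)
    ((integrable_deriv_smul F.2.1 h1 h2 _).smul v.2), integral_smul, integral_smul, d1, d2]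
  simp

/-- The homogeneous Sobolev space `H¹(ℝ²)`: functions of finite energy modulo constants. -/
def H1 : Type := energyFunctions ⧸ energyConstants

instance : AddCommGroup H1 := inferInstanceAs (AddCommGroup (energyFunctions ⧸ energyConstants))

instance : Module ℂ H1 := inferInstanceAs (Module ℂ (energyFunctions ⧸ energyConstants))

/-- The class modulo constants of a function of finite energy. -/
def H1.mk : energyFunctions →ₗ[ℂ] H1 := energyConstants.mkQ

/-- The gradient on classes modulo constants. -/
def H1.grad : H1 →ₗ[ℂ] L2Field := energyConstants.liftQ weakGrad energyConstants_le_ker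

theorem H1.grad_injective : Function.Injective H1.grad :=
  LinearMap.ker_eq_bot.1 (Submodule.ker_liftQ_eq_bot _ _ _ ker_weakGrad_le)

/-- The norm of `H¹(ℝ²)` is `‖F‖² = ∫ |∇F|²`. -/
instance : NormedAddCommGroup H1 := NormedAddCommGroup.induced H1 L2Field H1.grad H1.grad_injective

instance : NormedSpace ℂ H1 := NormedSpace.induced ℂ H1 L2Field H1.grad

/-- The norm, written out: `‖F‖² = ∫ |∂₁F|² + |∂₂F|²`. -/
theorem H1.norm_mk_sq (F : energyFunctions) :
    ‖H1.mk F‖ ^ 2 = ∫ p, (‖(weakGrad F).fst p‖ ^ 2 + ‖(weakGrad F).snd p‖ ^ 2) := by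
  have : ‖H1.mk F‖ ^ 2 = ‖(weakGrad F).fst‖ ^ 2 + ‖(weakGrad F).snd‖ ^ 2 :=
    WithLp.prod_norm_sq_eq_of_L2 (weakGrad F)
  rw [this, integral_add (L2_integrable_sq _) (L2_integrable_sq _),
    L2_norm_sq, L2_norm_sq]

/-! ### The space `H^{1/2}` on the line -/

/-- The difference quotient of a function on the line. -/
def diffQuot (f : ℝ → ℂ) (p : ℝ × ℝ) : ℂ := (f p.1 - f p.2) / ((p.1 - p.2 : ℝ) : ℂ)

/-- The complex vector space of the locally `L²` functions `f` on the line with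
`∫∫ |f(x) - f(y)|² / |x - y|² dx dy < ∞`. -/
def halfFunctions : Submodule ℂ (ℝ → ℂ) where
  carrier := {f | (∀ K : Set ℝ, IsCompact K → MemLp f 2 (volume.restrict K)) ∧
    MemLp (diffQuot f) 2 volume}
  zero_mem' := by
    have : diffQuot 0 = 0 := by ext p; simp [diffQuot]
    exact ⟨fun K _ => MemLp.zero, this ▸ MemLp.zero⟩
  add_mem' := by
    rintro f g ⟨hf, hf'⟩ ⟨hg, hg'⟩
    have : diffQuot (f + g) = diffQuot f + diffQuot g := by
      ext p; simp only [diffQuot, Pi.add_apply]; ring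
    exact ⟨fun K hK => (hf K hK).add (hg K hK), this ▸ hf'.add hg'⟩
  smul_mem' := by
    rintro a f ⟨hf, hf'⟩
    have : diffQuot (a • f) = a • diffQuot f := by
      ext p; simp only [diffQuot, Pi.smul_apply, smul_eq_mul]; ring
    exact ⟨fun K hK => (hf K hK).const_smul a, this ▸ hf'.const_smul a⟩

/-- The difference quotient as an element of `L²(ℝ²)`. -/
def diffQuotL2 : halfFunctions →ₗ[ℂ] Lp ℂ 2 (volume : Measure (ℝ × ℝ)) where
  toFun f := f.2.2.toLp
  map_add' f g := by
    rw [← MemLp.toLp_add]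
    congr 1
    ext p; simp only [diffQuot, Pi.add_apply, Submodule.coe_add]; ring
  map_smul' a f := by
    rw [RingHom.id_apply, ← MemLp.toLp_const_smul]
    congr 1
    ext p; simp only [diffQuot, Pi.smul_apply, Submodule.coe_smul, smul_eq_mul]; ring

/-- The functions in `halfFunctions` that are (almost everywhere equal to) constants. -/
def halfConstants : Submodule ℂ halfFunctions where
  carrier := {f | ∃ c : ℂ, (f : ℝ → ℂ) =ᵐ[volume] fun _ => c}
  zero_mem' := ⟨0, by rfl⟩
  add_mem' := by
    rintro F F' ⟨c, hc⟩ ⟨c', hc'⟩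
    exact ⟨c + c', hc.add hc'⟩
  smul_mem' := by
    rintro a F ⟨c, hc⟩
    exact ⟨a • c, hc.const_smul a⟩

theorem halfConstants_le_ker : halfConstants ≤ LinearMap.ker diffQuotL2 := by
  rintro f ⟨c, hc⟩
  refine LinearMap.mem_ker.2 (Lp.ext ?_)
  have h1 : ∀ᵐ p : ℝ × ℝ, (f : ℝ → ℂ) p.1 = c := Measure.quasiMeasurePreserving_fst.ae hc
  have h2 : ∀ᵐ p : ℝ × ℝ, (f : ℝ → ℂ) p.2 = c := Measure.quasiMeasurePreserving_snd.ae hc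
  filter_upwards [h1, h2, MemLp.coeFn_toLp f.2.2, Lp.coeFn_zero ℂ 2 (volume : Measure (ℝ × ℝ))]
    with p a b d e
  rw [e]
  refine d.trans ?_
  simp [diffQuot, a, b]

theorem ker_diffQuotL2_le : LinearMap.ker diffQuotL2 ≤ halfConstants := by
  intro f hf
  have h0 : ∀ᵐ p : ℝ × ℝ, diffQuot f p = 0 := by
    have a := MemLp.coeFn_toLp f.2.2
    have b : f.2.2.toLp = 0 := LinearMap.mem_ker.1 hf
    rw [b] at a
    filter_upwards [a, Lp.coeFn_zero ℂ 2 (volume : Measure (ℝ × ℝ))] with p h1 h2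
    rw [← h1, h2]; rfl
  obtain ⟨x, hx⟩ := (Measure.ae_ae_of_ae_prod h0).exists
  refine ⟨(f : ℝ → ℂ) x, ?_⟩
  filter_upwards [hx] with y hy
  rcases div_eq_zero_iff.1 hy with h | h
  · exact (sub_eq_zero.1 h).symm
  · have hxy : x = y := sub_eq_zero.1 (Complex.ofReal_eq_zero.1 h)
    rw [hxy]

/-- The homogeneous Sobolev space `H^{1/2}(ℝ)`, whose elements are classes modulo constants. -/
def Hhalf : Type := halfFunctions ⧸ halfConstants

instance : AddCommGroup Hhalf := inferInstanceAs (AddCommGroup (halfFunctions ⧸ halfConstants))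

instance : Module ℂ Hhalf := inferInstanceAs (Module ℂ (halfFunctions ⧸ halfConstants))

/-- The class modulo constants of a function. -/
def Hhalf.mk : halfFunctions →ₗ[ℂ] Hhalf := halfConstants.mkQ

/-- The difference quotient on classes modulo constants. -/
def Hhalf.quot : Hhalf →ₗ[ℂ] Lp ℂ 2 (volume : Measure (ℝ × ℝ)) :=
  halfConstants.liftQ diffQuotL2 halfConstants_le_ker

theorem Hhalf.quot_injective : Function.Injective Hhalf.quot :=
  LinearMap.ker_eq_bot.1 (Submodule.ker_liftQ_eq_bot _ _ _ ker_diffQuotL2_le)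

/-- The norm of `H^{1/2}(ℝ)` is `‖f‖² = ∫∫ |f(x) - f(y)|² / |x - y|² dx dy`. -/
instance : NormedAddCommGroup Hhalf :=
  NormedAddCommGroup.induced Hhalf (Lp ℂ 2 (volume : Measure (ℝ × ℝ))) Hhalf.quot
    Hhalf.quot_injective

instance : NormedSpace ℂ Hhalf :=
  NormedSpace.induced ℂ Hhalf (Lp ℂ 2 (volume : Measure (ℝ × ℝ))) Hhalf.quot

/-- The norm, written out: `‖f‖² = ∫∫ |f(x) - f(y)|² / |x - y|² dx dy`. -/
theorem Hhalf.norm_mk_sq (f : halfFunctions) :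
    ‖Hhalf.mk f‖ ^ 2 =
      ∫ p : ℝ × ℝ, ‖(f : ℝ → ℂ) p.1 - (f : ℝ → ℂ) p.2‖ ^ 2 / |p.1 - p.2| ^ 2 := by
  have h : ‖Hhalf.mk f‖ ^ 2 = ‖diffQuotL2 f‖ ^ 2 := rfl
  rw [h, L2_norm_sq]
  refine integral_congr_ae ?_
  filter_upwards [MemLp.coeFn_toLp f.2.2] with p hp
  have h' : diffQuotL2 f p = diffQuot f p := hp
  rw [h', diffQuot, norm_div, div_pow, Complex.norm_real, Real.norm_eq_abs]

/-! ### The trace on the line `y = 0` and the Poisson integral -/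

/-- The (almost everywhere defined) function `f` is the trace of `F` on the line `y = 0`:
the slices `F(·, y)` converge to `f` in `L²` on every bounded interval as `y → 0` (from both sides,
outside a null set of `y`, so that only the class of `F` modulo null sets matters). -/
def IsTrace (F : ℝ × ℝ → ℂ) (f : ℝ → ℂ) : Prop :=
  AEStronglyMeasurable f volume ∧ ∀ R : ℝ,
    Tendsto (fun y : ℝ => ∫⁻ x in Icc (-R) R, ‖F (x, y) - f x‖ₑ ^ 2) (ae volume ⊓ 𝓝 0) (𝓝 0)

/-- The Poisson integral `(|y| / π) ∫ f(x - t) / (t² + y²) dt` of `f` in the upper and in the lower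
half plane (the value on the null set `y = 0` is irrelevant). -/
def poissonExtension (f : ℝ → ℂ) (p : ℝ × ℝ) : ℂ :=
  ((|p.2| / Real.pi : ℝ) : ℂ) * ∫ t : ℝ, f (p.1 - t) / ((t ^ 2 + p.2 ^ 2 : ℝ) : ℂ)

end

/-!
The trace and the Poisson extension are treated by real-variable estimates for lower integrals; the
Fourier transform is not used. The main tool is Minkowski's integral inequality in `L²`
(`lintegral_sq_lintegral_le`): an average over a parameter `s` of functions whose `L²` norms are
bounded by `a(s) √A` has norm at most `(∫ a) √A`.

*Trace.* For a smooth `F`, the Cauchy–Schwarz inequality on vertical segments gives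
`‖F(·, y') - F(·, y)‖² ≤ |y' - y| ‖∂₂F‖²`. To bound the `H^{1/2}` norm of a slice, `(x, y)` is
joined to `(x + h, y)` by three sides of a square of side `|h|`; in the parameter `s ∈ (0, 1]` along
the sides, a change of variables gives `a(s) = O(s ^ (-1 / 2))`, which is integrable
(`lintegral_diffQuot_slice_le_of_contDiff`). Regularization does not increase the energy and
converges almost everywhere, so by Fatou's lemma both estimates hold on almost all slices of a
function of finite energy. Hence the slices form a Cauchy family as `y → 0`, their limit is the
trace, and Fatou's lemma bounds its `H^{1/2}` norm (`exists_trace`). Finiteness of that norm implies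
that a measurable function is locally `L²` (`mem_halfFunctions`).

*Extension.* Let `q(x, u)` be the difference quotient of `f`, and `q(x, ·) ∈ L²` for almost every
`x`. Since the Poisson kernel has integral one, the Cauchy–Schwarz inequality gives
`|Ef(x, y) - f(x)|² ≤ |y| ∫ |q(x, u)|² du` (`enorm_poissonExtension_sub_sq_le`), which yields both
the trace of `Ef` and the continuity of `Ef(x, ·)` across `y = 0` for almost every `x`. Off the axis
one differentiates under the integral. The derivatives of the kernel have mean zero and are bounded
by `1 / ((x - u)² + y²)`, so `|∇Ef(x, y)|` is bounded by `∫ |q(x, x + y s)| |s| / (1 + s²) ds`, and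
Minkowski's inequality with `a(s) = |s| ^ (1 / 2) / (1 + s²)` gives the energy estimate
(`lintegral_enorm_integral_sq_le`). Integration by parts on lines shows that the derivatives off the
axis are the weak derivatives on the whole plane (`isWeakDeriv_snd_of_ae_slice`).

Both estimates show that constants go to zero, so the maps pass to classes modulo constants;
linearity of the trace follows from its uniqueness (`IsTrace.ae_eq`).
-/

/-! ### Inequalities for lower integrals -/

theorem sq_lintegral_mul_le {α : Type*} [MeasurableSpace α] (μ : Measure α) {f g : α → ℝ≥0∞}
    (hf : AEMeasurable f μ) (hg : AEMeasurable g μ) :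
    (∫⁻ x, f x * g x ∂μ) ^ 2 ≤ (∫⁻ x, f x ^ 2 ∂μ) * ∫⁻ x, g x ^ 2 ∂μ := by
  have h := ENNReal.lintegral_mul_le_Lp_mul_Lq μ Real.HolderConjugate.two_two hf hg
  simp only [Pi.mul_apply, ENNReal.rpow_two] at h
  refine (pow_le_pow_left' h 2).trans (le_of_eq ?_)
  rw [mul_pow, ← ENNReal.rpow_mul_natCast, ← ENNReal.rpow_mul_natCast]
  norm_num

/-- A form of Minkowski's integral inequality in `L²`: if `‖G(·, s)‖² ≤ a(s)² A` for almost every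
`s`, then `‖∫ G(·, s) ds‖² ≤ (∫ a(s) ds)² A`. It is obtained by expanding the square of the inner
integral into a double integral. -/
theorem lintegral_sq_lintegral_le {α β : Type*} [MeasurableSpace α] [MeasurableSpace β]
    {μ : Measure α} {ν : Measure β} [SFinite μ] [SFinite ν] {G : α → β → ℝ≥0∞}
    (hG : Measurable (Function.uncurry G)) {a : β → ℝ≥0∞} (ha : Measurable a) {A : ℝ≥0∞}
    (h : ∀ᵐ s ∂ν, ∫⁻ x, G x s ^ 2 ∂μ ≤ a s ^ 2 * A) :
    ∫⁻ x, (∫⁻ s, G x s ∂ν) ^ 2 ∂μ ≤ (∫⁻ s, a s ∂ν) ^ 2 * A := by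
  have hG1 : ∀ x, Measurable (G x) := fun x => hG.comp measurable_prodMk_left
  have hG2 : ∀ s, Measurable fun x => G x s := fun s => hG.comp measurable_prodMk_right
  have e : ∀ x, (∫⁻ s, G x s ∂ν) ^ 2 = ∫⁻ s, ∫⁻ t, G x s * G x t ∂ν ∂ν := by
    intro x
    rw [sq, ← lintegral_mul_const _ (hG1 x)]
    refine lintegral_congr fun s => ?_
    rw [lintegral_const_mul _ (hG1 x)]
  have m3 : Measurable fun q : (α × β) × β => G q.1.1 q.1.2 * G q.1.1 q.2 :=
    (hG.comp measurable_fst).mul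
      (hG.comp ((measurable_fst.comp measurable_fst).prodMk measurable_snd))
  have m2 : ∀ s, Measurable fun q : α × β => G q.1 s * G q.1 q.2 := fun s =>
    ((hG2 s).comp measurable_fst).mul hG
  calc ∫⁻ x, (∫⁻ s, G x s ∂ν) ^ 2 ∂μ
      = ∫⁻ x, ∫⁻ s, ∫⁻ t, G x s * G x t ∂ν ∂ν ∂μ := lintegral_congr e
    _ = ∫⁻ s, ∫⁻ x, ∫⁻ t, G x s * G x t ∂ν ∂μ ∂ν :=
        lintegral_lintegral_swap m3.lintegral_prod_right'.aemeasurable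
    _ = ∫⁻ s, ∫⁻ t, ∫⁻ x, G x s * G x t ∂μ ∂ν ∂ν :=
        lintegral_congr fun s => lintegral_lintegral_swap (m2 s).aemeasurable
    _ ≤ ∫⁻ s, ∫⁻ t, a s * (a t * A) ∂ν ∂ν := by
        refine lintegral_mono_ae (h.mono fun s hs => lintegral_mono_ae (h.mono fun t ht => ?_))
        refine (ENNReal.pow_right_strictMono two_ne_zero).le_iff_le.1 ?_
        refine (sq_lintegral_mul_le μ (hG2 s).aemeasurable (hG2 t).aemeasurable).trans ?_
        refine (mul_le_mul' hs ht).trans (le_of_eq ?_)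
        ring
    _ = (∫⁻ s, a s ∂ν) ^ 2 * A := by
        simp only [lintegral_const_mul _ (ha.mul_const A), lintegral_mul_const _ ha]
        rw [sq, mul_assoc]

theorem ENNReal.add_sq_le_two_mul (a b : ℝ≥0∞) : (a + b) ^ 2 ≤ 2 * a ^ 2 + 2 * b ^ 2 := by
  have := ENNReal.rpow_add_le_mul_rpow_add_rpow a b (p := 2) (by norm_num)
  simp only [ENNReal.rpow_two] at this
  refine this.trans (le_of_eq ?_)
  norm_num [mul_add]

theorem lintegral_comp_add_mul {g : ℝ → ℝ≥0∞} (hg : Measurable g) (b : ℝ) {a : ℝ} (ha : a ≠ 0) :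
    ∫⁻ s, g (b + a * s) = ENNReal.ofReal |a⁻¹| * ∫⁻ s, g s := by
  have h : ∫⁻ s, g (b + s) = ∫⁻ s, g s := lintegral_add_left_eq_self g b
  rw [← h, ← lintegral_map (f := fun s => g (b + s)) (by fun_prop) (measurable_const_mul a),
    Real.map_volume_mul_left ha, lintegral_smul_measure, smul_eq_mul]

theorem measurable_diffQuot {f : ℝ → ℂ} (hf : Measurable f) : Measurable (diffQuot f) := by
  unfold diffQuot
  fun_prop

/-- The seminorm `∬ |f(x) - f(y)|² / |x - y|²` in the variables `x` and `h = (y - x) / c`. -/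
theorem lintegral_diffQuot_sq {f : ℝ → ℂ} (hf : Measurable f) {c : ℝ} (hc : c ≠ 0) :
    ∫⁻ x, ∫⁻ h, ‖diffQuot f (x, x + c * h)‖ₑ ^ 2 =
      ENNReal.ofReal |c⁻¹| * ∫⁻ p, ‖diffQuot f p‖ₑ ^ 2 := by
  have m := measurable_diffQuot hf
  have m' : Measurable fun p => ‖diffQuot f p‖ₑ ^ 2 := m.enorm.pow_const 2
  rw [Measure.volume_eq_prod, lintegral_prod _ m'.aemeasurable,
    ← lintegral_const_mul _ m'.lintegral_prod_right']
  refine lintegral_congr fun x => ?_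
  exact lintegral_comp_add_mul (g := fun y => ‖diffQuot f (x, y)‖ₑ ^ 2)
    (m'.comp measurable_prodMk_left) x hc

/-! ### Estimates for smooth functions -/

theorem enorm_add_sub_le_lintegral_fderiv {E : Type*} [NormedAddCommGroup E] [NormedSpace ℝ E]
    {F : E → ℂ} (hF : ContDiff ℝ 1 F) (p w : E) :
    ‖F (p + w) - F p‖ₑ ≤ ∫⁻ s in Ioc (0 : ℝ) 1, ‖fderiv ℝ F (p + s • w) w‖ₑ := by
  have hd : ∀ s : ℝ, HasDerivAt (fun s : ℝ => F (p + s • w)) (fderiv ℝ F (p + s • w) w) s := by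
    intro s
    have h1 : HasDerivAt (fun s : ℝ => p + s • w) w s := by
      simpa using ((hasDerivAt_id s).smul_const w).const_add p
    exact ((hF.differentiable (by simp) _).hasFDerivAt).comp_hasDerivAt s h1
  have hc : Continuous fun s : ℝ => fderiv ℝ F (p + s • w) w :=
    ((hF.continuous_fderiv (by simp)).comp (by fun_prop)).clm_apply continuous_const
  have := intervalIntegral.integral_eq_sub_of_hasDerivAt (a := 0) (b := 1) (fun s _ => hd s)
    (hc.intervalIntegrable _ _)
  simp only [one_smul, zero_smul, add_zero] at this
  rw [← this, intervalIntegral.integral_of_le zero_le_one]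
  exact enorm_integral_le_lintegral_enorm _

theorem measurable_enorm_fderiv_apply {F : ℝ × ℝ → ℂ} (hF : ContDiff ℝ 1 F) (v : ℝ × ℝ) :
    Measurable fun p => ‖fderiv ℝ F p v‖ₑ :=
  ((hF.continuous_fderiv (by simp)).clm_apply continuous_const).enorm.measurable

/-- Two slices of a smooth function of finite energy differ by a square integrable function, by the
Cauchy–Schwarz inequality on the vertical segments between them. -/
theorem lintegral_sub_sq_le_of_contDiff {F : ℝ × ℝ → ℂ} (hF : ContDiff ℝ 1 F) (y y' : ℝ) :
    ∫⁻ x, ‖F (x, y') - F (x, y)‖ₑ ^ 2 ≤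
      ‖y' - y‖ₑ * ∫⁻ p, ‖fderiv ℝ F p (0, 1)‖ₑ ^ 2 := by
  have m := measurable_enorm_fderiv_apply hF (0, 1)
  have m' : Measurable fun p => ‖fderiv ℝ F p (0, 1)‖ₑ ^ 2 := m.pow_const 2
  rcases eq_or_ne (y' - y) 0 with h0 | h0
  · rw [sub_eq_zero.1 h0]; simp
  set h := y' - y
  have hy : y' = y + h := by simp [h]
  have key : ∀ x, ‖F (x, y') - F (x, y)‖ₑ ^ 2 ≤
      ‖h‖ₑ * ∫⁻ s, ‖fderiv ℝ F (x, s) (0, 1)‖ₑ ^ 2 := by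
    intro x
    have h1 := enorm_add_sub_le_lintegral_fderiv hF (x, y) (0, h)
    have e1 : ∀ s : ℝ, ‖fderiv ℝ F ((x, y) + s • (0, h)) (0, h)‖ₑ
        = ‖h‖ₑ * ‖fderiv ℝ F (x, y + h * s) (0, 1)‖ₑ := by
      intro s
      have : ((0, h) : ℝ × ℝ) = h • (0, 1) := by simp
      rw [this, map_smul, enorm_smul]
      simp [mul_comm]
    simp only [e1, Prod.mk_add_mk, add_zero, ← hy] at h1
    have m1 : Measurable fun s => ‖fderiv ℝ F (x, y + h * s) (0, 1)‖ₑ := m.comp (by fun_prop)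
    have h2 := sq_lintegral_mul_le (volume.restrict (Ioc (0 : ℝ) 1)) (f := fun _ => ‖h‖ₑ)
      aemeasurable_const m1.aemeasurable
    refine (pow_le_pow_left' h1 2).trans (h2.trans ?_)
    simp only [lintegral_const, Measure.restrict_apply_univ, Real.volume_Ioc]
    refine (mul_le_mul_right (setLIntegral_le_lintegral _ _) _).trans (le_of_eq ?_)
    rw [lintegral_comp_add_mul (g := fun s => ‖fderiv ℝ F (x, s) (0, 1)‖ₑ ^ 2)
      (m'.comp measurable_prodMk_left) y h0, ← mul_assoc]
    congr 1
    have : ENNReal.ofReal |h⁻¹| = ‖h‖ₑ⁻¹ := by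
      rw [← Real.enorm_eq_ofReal_abs, enorm_inv h0]
    rw [this, sq]
    simp only [sub_zero, ENNReal.ofReal_one, mul_one]
    rw [mul_assoc, ENNReal.mul_inv_cancel (by simpa using h0) (by simp), mul_one]
  refine (lintegral_mono key).trans (le_of_eq ?_)
  rw [lintegral_const_mul _ m'.lintegral_prod_right', Measure.volume_eq_prod,
    lintegral_prod _ m'.aemeasurable]

theorem lintegral_Ioc_rpow_neg_half :
    ∫⁻ s in Ioc (0 : ℝ) 1, ENNReal.ofReal (s ^ (-1 / 2 : ℝ)) = 2 := by
  rw [← ofReal_integral_eq_lintegral_ofReal]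
  · rw [← intervalIntegral.integral_of_le zero_le_one, integral_rpow (by norm_num)]
    norm_num
  · exact (intervalIntegrable_iff_integrableOn_Ioc_of_le zero_le_one).1
      (intervalIntegral.intervalIntegrable_rpow' (by norm_num))
  · filter_upwards [ae_restrict_mem measurableSet_Ioc] with s hs
    exact Real.rpow_nonneg hs.1.le _

/-- The trace inequality for smooth functions: the points `(x, y)` and `(x + h, y)` are joined by
the three sides of a square over the segment between them. -/
theorem lintegral_diffQuot_slice_le_of_contDiff {F : ℝ × ℝ → ℂ} (hF : ContDiff ℝ 1 F)
    (y : ℝ) :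
    ∫⁻ p, ‖diffQuot (fun x => F (x, y)) p‖ₑ ^ 2 ≤
      64 * ((∫⁻ p, ‖fderiv ℝ F p (1, 0)‖ₑ ^ 2) + ∫⁻ p, ‖fderiv ℝ F p (0, 1)‖ₑ ^ 2) := by
  set d1 : ℝ × ℝ → ℝ≥0∞ := fun p => ‖fderiv ℝ F p (1, 0)‖ₑ with hd1
  set d2 : ℝ × ℝ → ℝ≥0∞ := fun p => ‖fderiv ℝ F p (0, 1)‖ₑ with hd2
  have m1 : Measurable d1 := measurable_enorm_fderiv_apply hF (1, 0)
  have m2 : Measurable d2 := measurable_enorm_fderiv_apply hF (0, 1)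
  let G : ℝ × ℝ → ℝ → ℝ≥0∞ := fun q s =>
    d2 (q.1, y + s * q.2) + d1 (q.1 + s * q.2, y + q.2) + d2 (q.1 + q.2, y + s * q.2)
  have hG : Measurable (Function.uncurry G) := by
    refine ((m2.comp ?_).add (m1.comp ?_)).add (m2.comp ?_) <;> fun_prop
  have hf : Measurable fun x => F (x, y) := by
    have := hF.continuous
    exact (by fun_prop : Continuous fun x => F (x, y)).measurable
  have hsc : ∀ (s : ℝ), 0 < s → ∀ d : ℝ × ℝ → ℝ≥0∞, Measurable d → ∀ z : ℝ,
      ∫⁻ q : ℝ × ℝ, d (q.1 + z * q.2, y + s * q.2) ^ 2 = ENNReal.ofReal s⁻¹ * ∫⁻ p, d p ^ 2 := by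
    intro s hs d hd z
    have hd' : Measurable fun p => d p ^ 2 := hd.pow_const 2
    rw [Measure.volume_eq_prod, lintegral_prod_symm' _ (by fun_prop),
      lintegral_prod_symm' _ hd']
    have : ∀ h, ∫⁻ x, d (x + z * h, y + s * h) ^ 2 = ∫⁻ x, d (x, y + s * h) ^ 2 := fun h =>
      lintegral_add_right_eq_self (fun x => d (x, y + s * h) ^ 2) _
    simp only [this]
    rw [lintegral_comp_add_mul (g := fun v => ∫⁻ x, d (x, v) ^ 2) hd'.lintegral_prod_left' y hs.ne',
      abs_of_pos (inv_pos.2 hs)]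
  have key : ∀ᵐ s ∂(volume.restrict (Ioc (0 : ℝ) 1)), ∫⁻ q, G q s ^ 2 ≤
      (4 * ENNReal.ofReal (s ^ (-1 / 2 : ℝ))) ^ 2 * ((∫⁻ p, d1 p ^ 2) + ∫⁻ p, d2 p ^ 2) := by
    filter_upwards [ae_restrict_mem measurableSet_Ioc] with s hs
    have hs1 : (1 : ℝ≥0∞) ≤ ENNReal.ofReal s⁻¹ :=
      ENNReal.one_le_ofReal.2 ((one_le_inv₀ hs.1).2 hs.2)
    have ea : ENNReal.ofReal (s ^ (-1 / 2 : ℝ)) ^ 2 = ENNReal.ofReal s⁻¹ := by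
      rw [← ENNReal.ofReal_pow (Real.rpow_nonneg hs.1.le _), ← Real.rpow_mul_natCast hs.1.le]
      norm_num [Real.rpow_neg_one]
    -- The vertical sides contribute `1 / s` by scaling in the second variable; the horizontal side
    -- amounts to a linear change of variables of determinant `1`.
    have e1 := hsc s hs.1 d2 m2 0
    have e2 := hsc 1 one_pos d1 m1 s
    have e3 := hsc s hs.1 d2 m2 1
    simp only [zero_mul, add_zero, one_mul, inv_one, ENNReal.ofReal_one] at e1 e2 e3
    calc ∫⁻ q, G q s ^ 2
        ≤ ∫⁻ q : ℝ × ℝ, (4 * d2 (q.1, y + s * q.2) ^ 2 + 4 * d1 (q.1 + s * q.2, y + q.2) ^ 2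
            + 2 * d2 (q.1 + q.2, y + s * q.2) ^ 2) := by
          refine lintegral_mono fun q => (ENNReal.add_sq_le_two_mul _ _).trans ?_
          refine add_le_add_left ((mul_le_mul_right (ENNReal.add_sq_le_two_mul _ _) 2).trans
            (le_of_eq ?_)) _
          ring
      _ = 4 * (ENNReal.ofReal s⁻¹ * ∫⁻ p, d2 p ^ 2) + 4 * (∫⁻ p, d1 p ^ 2)
            + 2 * (ENNReal.ofReal s⁻¹ * ∫⁻ p, d2 p ^ 2) := by
          have n1 : Measurable fun q : ℝ × ℝ => d2 (q.1, y + s * q.2) ^ 2 := by fun_prop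
          have n2 : Measurable fun q : ℝ × ℝ => d1 (q.1 + s * q.2, y + q.2) ^ 2 := by fun_prop
          have n3 : Measurable fun q : ℝ × ℝ => d2 (q.1 + q.2, y + s * q.2) ^ 2 := by fun_prop
          rw [lintegral_add_left (by fun_prop), lintegral_add_left (by fun_prop),
            lintegral_const_mul _ n1, lintegral_const_mul _ n2, lintegral_const_mul _ n3,
            e1, e2, e3]
      _ ≤ 16 * ENNReal.ofReal s⁻¹ * (∫⁻ p, d1 p ^ 2) +
            16 * ENNReal.ofReal s⁻¹ * ∫⁻ p, d2 p ^ 2 := by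
          have i1 : 4 * ∫⁻ p, d1 p ^ 2 ≤ 16 * ENNReal.ofReal s⁻¹ * ∫⁻ p, d1 p ^ 2 := by
            refine mul_le_mul_left ?_ _
            calc (4 : ℝ≥0∞) ≤ 16 * 1 := by norm_num
              _ ≤ _ := by gcongr
          have i2 : 4 * (ENNReal.ofReal s⁻¹ * ∫⁻ p, d2 p ^ 2)
              + 2 * (ENNReal.ofReal s⁻¹ * ∫⁻ p, d2 p ^ 2)
              ≤ 16 * ENNReal.ofReal s⁻¹ * ∫⁻ p, d2 p ^ 2 := by
            rw [← add_mul, mul_assoc]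
            exact mul_le_mul_left (by norm_num) _
          calc _ = 4 * (∫⁻ p, d1 p ^ 2) + (4 * (ENNReal.ofReal s⁻¹ * ∫⁻ p, d2 p ^ 2)
              + 2 * (ENNReal.ofReal s⁻¹ * ∫⁻ p, d2 p ^ 2)) := by ring
            _ ≤ _ := add_le_add i1 i2
      _ = _ := by rw [mul_pow, ea]; ring
  have key2 := lintegral_sq_lintegral_le hG (by fun_prop) key
  rw [lintegral_const_mul _ (by fun_prop), lintegral_Ioc_rpow_neg_half] at key2
  refine le_trans ?_ (key2.trans (le_of_eq (by rw [show ((4 : ℝ≥0∞) * 2) ^ 2 = 64 by norm_num])))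
  have e := lintegral_diffQuot_sq hf one_ne_zero
  simp only [inv_one, abs_one, ENNReal.ofReal_one, one_mul] at e
  rw [← e, Measure.volume_eq_prod, lintegral_prod _ (by fun_prop)]
  refine lintegral_mono fun x => lintegral_mono fun h => pow_le_pow_left' ?_ 2
  rcases eq_or_ne h 0 with rfl | h0
  · simp [diffQuot]
  have b1 := enorm_add_sub_le_lintegral_fderiv hF (x, y) (0, h)
  have b2 := enorm_add_sub_le_lintegral_fderiv hF (x, y + h) (h, 0)
  have b3 := enorm_add_sub_le_lintegral_fderiv hF (x + h, y) (0, h)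
  have e1 : ((0, h) : ℝ × ℝ) = h • (0, 1) := by simp
  have e2 : ((h, 0) : ℝ × ℝ) = h • (1, 0) := by simp
  have c1 : ∀ p, ‖fderiv ℝ F p (0, h)‖ₑ = ‖h‖ₑ * d2 p := fun p => by
    rw [e1, map_smul, enorm_smul]
  have c2 : ∀ p, ‖fderiv ℝ F p (h, 0)‖ₑ = ‖h‖ₑ * d1 p := fun p => by
    rw [e2, map_smul, enorm_smul]
  simp only [c1, c2, Prod.mk_add_mk, Prod.smul_mk, smul_eq_mul, mul_zero, add_zero] at b1 b2 b3
  rw [lintegral_const_mul _ (by fun_prop)] at b1 b2 b3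
  have hsum : ∫⁻ s in Ioc (0 : ℝ) 1, G (x, h) s = (∫⁻ s in Ioc (0 : ℝ) 1, d2 (x, y + s * h))
      + (∫⁻ s in Ioc (0 : ℝ) 1, d1 (x + s * h, y + h))
      + ∫⁻ s in Ioc (0 : ℝ) 1, d2 (x + h, y + s * h) := by
    rw [← lintegral_add_left (by fun_prop), ← lintegral_add_left (by fun_prop)]
  have hq : ‖diffQuot (fun x => F (x, y)) (x, x + h)‖ₑ = ‖h‖ₑ⁻¹ * ‖F (x + h, y) - F (x, y)‖ₑ := by
    have : ‖((x - (x + h) : ℝ) : ℂ)‖ₑ = ‖h‖ₑ := by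
      rw [sub_add_cancel_left, ← enorm_neg h, ← ofReal_norm, ← ofReal_norm, Complex.norm_real]
    have hne : ((x - (x + h) : ℝ) : ℂ) ≠ 0 := by
      simpa using h0
    simp only [diffQuot]
    rw [div_eq_mul_inv, enorm_mul, enorm_inv hne, this, mul_comm,
      ← enorm_neg (F (x, y) - _), neg_sub]
  rw [hq, hsum]
  have htri : F (x + h, y) - F (x, y) = (F (x, y + h) - F (x, y)) +
      (F (x + h, y + h) - F (x, y + h)) + -(F (x + h, y + h) - F (x + h, y)) := by ring
  have hb : ‖F (x + h, y) - F (x, y)‖ₑ ≤ ‖h‖ₑ * ((∫⁻ s in Ioc (0 : ℝ) 1, d2 (x, y + s * h))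
      + (∫⁻ s in Ioc (0 : ℝ) 1, d1 (x + s * h, y + h))
      + ∫⁻ s in Ioc (0 : ℝ) 1, d2 (x + h, y + s * h)) := by
    rw [htri, mul_add, mul_add]
    refine (enorm_add_le _ _).trans (add_le_add ((enorm_add_le _ _).trans (add_le_add b1 b2)) ?_)
    rw [enorm_neg]
    exact b3
  refine (mul_le_mul_right hb _).trans (le_of_eq ?_)
  rw [← mul_assoc, ENNReal.inv_mul_cancel (by simpa using h0) (by simp), one_mul]

/-! ### Regularization of functions of finite energy -/

/-- The derivative of a regularization is the regularization of the weak derivative. -/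
theorem fderiv_convolution_eq {F : ℝ × ℝ → ℂ} (hF : LocallyIntegrable F) {v : ℝ × ℝ}
    {g : ℝ × ℝ → ℂ} (h : IsWeakDeriv v F g) {ρ : ℝ × ℝ → ℝ} (h1 : ContDiff ℝ ∞ ρ)
    (h2 : HasCompactSupport ρ) (x : ℝ × ℝ) :
    fderiv ℝ (convolution F ρ (ContinuousLinearMap.lsmul ℝ ℝ).flip volume) x v =
      ∫ t, ρ t • g (x - t) := by
  set L : ℂ →L[ℝ] ℝ →L[ℝ] ℂ := (ContinuousLinearMap.lsmul ℝ ℝ).flip with hL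
  have hd := h2.hasFDerivAt_convolution_right L hF (h1.of_le (by simp)) x
  rw [hd.fderiv, convolution_precompR_apply L hF (h2.fderiv ℝ) (h1.continuous_fderiv (by simp)),
    convolution_def]
  have hφ1 : ContDiff ℝ ∞ (fun t => ρ (x - t)) := h1.comp (contDiff_const.sub contDiff_id)
  have hφ2 : HasCompactSupport (fun t => ρ (x - t)) :=
    h2.comp_homeomorph (Homeomorph.subLeft x)
  have := h _ hφ1 hφ2
  have e : ∀ t, fderiv ℝ (fun t => ρ (x - t)) t v = -(fderiv ℝ ρ (x - t) v) := by
    intro t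
    have a : HasFDerivAt (fun t => x - t) (-ContinuousLinearMap.id ℝ (ℝ × ℝ)) t := by
      simpa using (hasFDerivAt_id t).const_sub x
    have b := (((h1.differentiable (by simp) (x - t)).hasFDerivAt).comp t a).fderiv
    simp only [Function.comp_def] at b
    rw [b]
    simp
  simp only [e, neg_smul, integral_neg, neg_inj] at this
  rw [← integral_sub_left_eq_self (fun t => ρ t • g (x - t)) volume x]
  simpa [hL] using this

/-- Averaging translates with a probability density does not increase the `L²` norm. -/
theorem lintegral_enorm_convolution_sq_le {ρ : ℝ × ℝ → ℝ} (hρ : Continuous ρ)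
    (h0 : ∀ t, 0 ≤ ρ t) (hi : Integrable ρ) (h1 : ∫ t, ρ t = 1) {g : ℝ × ℝ → ℂ}
    (hg : Measurable g) :
    ∫⁻ x, ‖∫ t, ρ t • g (x - t)‖ₑ ^ 2 ≤ ∫⁻ x, ‖g x‖ₑ ^ 2 := by
  have hρ1 : ∫⁻ t, ‖ρ t‖ₑ = 1 := by
    rw [← ofReal_integral_norm_eq_lintegral_enorm hi]
    simp only [Real.norm_of_nonneg (h0 _), h1, ENNReal.ofReal_one]
  have hm := hρ.measurable
  calc ∫⁻ x, ‖∫ t, ρ t • g (x - t)‖ₑ ^ 2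
      ≤ ∫⁻ x, (∫⁻ t, ‖ρ t‖ₑ * ‖g (x - t)‖ₑ) ^ 2 := by
        refine lintegral_mono fun x => pow_le_pow_left' ?_ 2
        refine (enorm_integral_le_lintegral_enorm _).trans (le_of_eq ?_)
        simp only [enorm_smul]
    _ ≤ (∫⁻ t, ‖ρ t‖ₑ) ^ 2 * ∫⁻ x, ‖g x‖ₑ ^ 2 := by
        refine lintegral_sq_lintegral_le (G := fun x t => ‖ρ t‖ₑ * ‖g (x - t)‖ₑ) (by fun_prop)
          (by fun_prop) (ae_of_all _ fun t => le_of_eq ?_)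
        simp only [mul_pow]
        rw [lintegral_const_mul _ (by fun_prop),
          lintegral_sub_right_eq_self (fun x => ‖g x‖ₑ ^ 2) t]
    _ = _ := by rw [hρ1, one_pow, one_mul]

/-- Regularizations of a function of finite energy converge to it almost everywhere, and their
energy is bounded by its energy. -/
theorem exists_contDiff_approx {F : ℝ × ℝ → ℂ} (hF : LocallyIntegrable F) {G : L2Field}
    (hG : IsWeakGrad F G) :
    ∃ u : ℕ → ℝ × ℝ → ℂ, (∀ n, ContDiff ℝ 1 (u n)) ∧
      (∀ n, ∫⁻ p, ‖fderiv ℝ (u n) p (1, 0)‖ₑ ^ 2 ≤ ∫⁻ p, ‖G.fst p‖ₑ ^ 2) ∧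
      (∀ n, ∫⁻ p, ‖fderiv ℝ (u n) p (0, 1)‖ₑ ^ 2 ≤ ∫⁻ p, ‖G.snd p‖ₑ ^ 2) ∧
      ∀ᵐ p, Tendsto (fun n => u n p) atTop (𝓝 (F p)) := by
  let φ : ℕ → ContDiffBump (0 : ℝ × ℝ) := fun n =>
    ⟨1 / ((n : ℝ) + 1), 2 * (1 / ((n : ℝ) + 1)), by positivity, by
      have : 0 < 1 / ((n : ℝ) + 1) := by positivity
      linarith⟩
  have hlim := ContDiffBump.ae_convolution_tendsto_right_of_locallyIntegrable (μ := volume)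
    (φ := φ) (l := atTop) (K := 2)
    (by simpa [φ] using (tendsto_one_div_add_atTop_nhds_zero_nat (𝕜 := ℝ)).const_mul 2)
    (Eventually.of_forall fun n => le_rfl) hF
  refine ⟨fun n => convolution F ((φ n).normed volume) (ContinuousLinearMap.lsmul ℝ ℝ).flip volume,
    fun n => ?_, fun n => ?_, fun n => ?_, ?_⟩
  · exact (φ n).hasCompactSupport_normed.contDiff_convolution_right _ hF (φ n).contDiff_normed
  · simp only [fderiv_convolution_eq hF hG.1 (φ n).contDiff_normed (φ n).hasCompactSupport_normed]
    exact lintegral_enorm_convolution_sq_le (φ n).continuous_normed (φ n).nonneg_normed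
      (φ n).integrable_normed (φ n).integral_normed (Lp.stronglyMeasurable _).measurable
  · simp only [fderiv_convolution_eq hF hG.2 (φ n).contDiff_normed (φ n).hasCompactSupport_normed]
    exact lintegral_enorm_convolution_sq_le (φ n).continuous_normed (φ n).nonneg_normed
      (φ n).integrable_normed (φ n).integral_normed (Lp.stronglyMeasurable _).measurable
  · simpa only [convolution_flip] using hlim

/-! ### Square integrable functions and difference quotients -/

theorem memLp_two_of_lintegral_lt_top {α : Type*} [MeasurableSpace α] {μ : Measure α} {f : α → ℂ}
    (hf : AEStronglyMeasurable f μ) (h : ∫⁻ x, ‖f x‖ₑ ^ 2 ∂μ < ⊤) : MemLp f 2 μ := by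
  refine ⟨hf, ?_⟩
  rw [eLpNorm_lt_top_iff_lintegral_rpow_enorm_lt_top (by norm_num) (by norm_num)]
  simpa using h

theorem MeasureTheory.MemLp.lintegral_enorm_sq_lt_top {α : Type*} [MeasurableSpace α]
    {μ : Measure α} {f : α → ℂ} (h : MemLp f 2 μ) : ∫⁻ x, ‖f x‖ₑ ^ 2 ∂μ < ⊤ := by
  have := h.2
  rw [eLpNorm_lt_top_iff_lintegral_rpow_enorm_lt_top (by norm_num) (by norm_num)] at this
  simpa using this

theorem ofReal_norm_sq_eq_lintegral (g : Lp ℂ 2 (volume : Measure (ℝ × ℝ))) :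
    ENNReal.ofReal (‖g‖ ^ 2) = ∫⁻ p, ‖g p‖ₑ ^ 2 := by
  rw [L2_norm_sq, ofReal_integral_eq_lintegral_ofReal (L2_integrable_sq g)
    (ae_of_all _ fun p => by positivity)]
  refine lintegral_congr fun p => ?_
  rw [ENNReal.ofReal_pow (norm_nonneg _), ofReal_norm]

/-- Fatou's lemma for the `L²` norm along an almost everywhere convergent sequence. -/
theorem lintegral_enorm_sq_le_of_tendsto {α : Type*} [MeasurableSpace α] {μ : Measure α}
    {u : ℕ → α → ℂ} {f : α → ℂ} (hu : ∀ n, AEStronglyMeasurable (u n) μ)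
    (h : ∀ᵐ x ∂μ, Tendsto (fun n => u n x) atTop (𝓝 (f x))) {B : ℕ → ℝ≥0∞} {C : ℝ≥0∞}
    (hB : ∀ n, ∫⁻ x, ‖u n x‖ₑ ^ 2 ∂μ ≤ B n) (hC : Tendsto B atTop (𝓝 C)) :
    ∫⁻ x, ‖f x‖ₑ ^ 2 ∂μ ≤ C := by
  have e : ∫⁻ x, ‖f x‖ₑ ^ 2 ∂μ = ∫⁻ x, liminf (fun n => ‖u n x‖ₑ ^ 2) atTop ∂μ := by
    refine lintegral_congr_ae (h.mono fun x hx => ?_)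
    exact (((ENNReal.continuous_pow 2).tendsto _).comp hx.enorm).liminf_eq.symm
  rw [e]
  refine (lintegral_liminf_le' fun n => (hu n).enorm.pow_const 2).trans ?_
  rw [← hC.liminf_eq]
  exact liminf_le_liminf (Eventually.of_forall hB)

theorem aestronglyMeasurable_diffQuot {f : ℝ → ℂ} (hf : AEStronglyMeasurable f volume) :
    AEStronglyMeasurable (diffQuot f) volume := by
  have h1 : AEStronglyMeasurable (fun p : ℝ × ℝ => f p.1) volume :=
    hf.comp_quasiMeasurePreserving Measure.quasiMeasurePreserving_fst
  have h2 : AEStronglyMeasurable (fun p : ℝ × ℝ => f p.2) volume :=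
    hf.comp_quasiMeasurePreserving Measure.quasiMeasurePreserving_snd
  have h3 : AEStronglyMeasurable (fun p : ℝ × ℝ => ((p.1 - p.2 : ℝ) : ℂ)) volume :=
    (by fun_prop : Continuous fun p : ℝ × ℝ => ((p.1 - p.2 : ℝ) : ℂ)).aestronglyMeasurable
  exact ((h1.sub h2).aemeasurable.div h3.aemeasurable).aestronglyMeasurable

theorem diffQuot_ae_eq {f g : ℝ → ℂ} (h : f =ᵐ[volume] g) : diffQuot f =ᵐ[volume] diffQuot g := by
  have h1 : ∀ᵐ p : ℝ × ℝ, f p.1 = g p.1 := Measure.quasiMeasurePreserving_fst.ae h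
  have h2 : ∀ᵐ p : ℝ × ℝ, f p.2 = g p.2 := Measure.quasiMeasurePreserving_snd.ae h
  filter_upwards [h1, h2] with p a b
  simp [diffQuot, a, b]

theorem lintegral_diffQuot_sq_le_of_tendsto {u : ℕ → ℝ → ℂ} {f : ℝ → ℂ}
    (hu : ∀ n, AEStronglyMeasurable (u n) volume)
    (h : ∀ᵐ x, Tendsto (fun n => u n x) atTop (𝓝 (f x))) {C : ℝ≥0∞}
    (hC : ∀ n, ∫⁻ p, ‖diffQuot (u n) p‖ₑ ^ 2 ≤ C) : ∫⁻ p, ‖diffQuot f p‖ₑ ^ 2 ≤ C := by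
  refine lintegral_enorm_sq_le_of_tendsto (fun n => aestronglyMeasurable_diffQuot (hu n)) ?_ hC
    tendsto_const_nhds
  have h1 : ∀ᵐ p : ℝ × ℝ, Tendsto (fun n => u n p.1) atTop (𝓝 (f p.1)) :=
    Measure.quasiMeasurePreserving_fst.ae h
  have h2 : ∀ᵐ p : ℝ × ℝ, Tendsto (fun n => u n p.2) atTop (𝓝 (f p.2)) :=
    Measure.quasiMeasurePreserving_snd.ae h
  filter_upwards [h1, h2] with p a b
  exact (a.sub b).div_const _

theorem sub_eq_mul_diffQuot (f : ℝ → ℂ) (x u : ℝ) :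
    f x - f u = ((x - u : ℝ) : ℂ) * diffQuot f (x, u) := by
  rcases eq_or_ne x u with rfl | hxu
  · simp
  rw [diffQuot, mul_div_cancel₀]
  exact_mod_cast sub_ne_zero.2 hxu

/-- A measurable function with finite `H^{1/2}` seminorm is locally square integrable, since its
difference quotients `(f(x) - f(y)) / (x - y)` are square integrable in `y` for almost every `x`. -/
theorem mem_halfFunctions {f : ℝ → ℂ} (hf : AEStronglyMeasurable f volume)
    (h : ∫⁻ p, ‖diffQuot f p‖ₑ ^ 2 < ⊤) : f ∈ halfFunctions := by
  have hd := memLp_two_of_lintegral_lt_top (aestronglyMeasurable_diffQuot hf) h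
  refine ⟨fun K hK => ?_, hd⟩
  have ht : ∀ᵐ x, ∫⁻ y, ‖diffQuot f (x, y)‖ₑ ^ 2 < ⊤ := by
    rw [Measure.volume_eq_prod, lintegral_prod _ (hd.1.enorm.pow_const 2)] at h
    exact ae_lt_top' ((hd.1.enorm.pow_const 2).lintegral_prod_right') h.ne
  obtain ⟨x, hx, hmx⟩ := (ht.and (hd.1.prodMk_left)).exists
  have hx2 : MemLp (fun y => diffQuot f (x, y)) 2 volume := memLp_two_of_lintegral_lt_top hmx hx
  obtain ⟨C, hC⟩ := hK.exists_bound_of_continuousOn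
    (f := fun y => (((x - y : ℝ)) : ℂ)) (by fun_prop)
  have : IsFiniteMeasure (volume.restrict K) := ⟨by simpa using hK.measure_lt_top⟩
  have h1 : MemLp (fun y => f x - f y) 2 (volume.restrict K) := by
    refine MemLp.of_le_mul (c := C) (hx2.restrict K)
      (aestronglyMeasurable_const.sub hf.restrict) ?_
    filter_upwards [ae_restrict_mem hK.measurableSet] with y hy
    rw [sub_eq_mul_diffQuot, norm_mul]
    exact mul_le_mul_of_nonneg_right (hC y hy) (norm_nonneg _)
  have h2 := (memLp_const (f x) (p := 2) (μ := volume.restrict K)).sub h1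
  simpa [Pi.sub_def] using h2

/-! ### Uniqueness of the trace -/

instance neBot_ae_inf_nhds (x : ℝ) : NeBot (ae (volume : Measure ℝ) ⊓ 𝓝 x) := by
  refine inf_neBot_iff.2 fun s hs t ht => ?_
  exact (Measure.dense_of_ae (μ := (volume : Measure ℝ)) hs).inter_nhds_nonempty ht

theorem ae_aestronglyMeasurable_slice {F : ℝ × ℝ → ℂ} (hF : AEStronglyMeasurable F volume) :
    ∀ᵐ y, AEStronglyMeasurable (fun x => F (x, y)) volume :=
  hF.prod_swap.prodMk_left

theorem IsTrace.ae_eq {F : ℝ × ℝ → ℂ} (hF : AEStronglyMeasurable F volume) {f g : ℝ → ℂ}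
    (hf : IsTrace F f) (hg : IsTrace F g) : f =ᵐ[volume] g := by
  have key : ∀ n : ℕ, ∀ᵐ x, x ∈ Icc (-(n : ℝ)) n → f x = g x := by
    intro n
    have hle : ∀ᶠ y in ae volume ⊓ 𝓝 (0 : ℝ), ∫⁻ x in Icc (-(n : ℝ)) n, ‖f x - g x‖ₑ ^ 2 ≤
        2 * (∫⁻ x in Icc (-(n : ℝ)) n, ‖F (x, y) - f x‖ₑ ^ 2) +
        2 * ∫⁻ x in Icc (-(n : ℝ)) n, ‖F (x, y) - g x‖ₑ ^ 2 := by
      refine Eventually.filter_mono inf_le_left ?_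
      filter_upwards [ae_aestronglyMeasurable_slice hF] with y hy
      have m1 : AEMeasurable (fun x => ‖F (x, y) - f x‖ₑ ^ 2)
          (volume.restrict (Icc (-(n : ℝ)) n)) :=
        ((hy.sub hf.1).enorm.pow_const 2).restrict
      rw [← lintegral_const_mul' _ _ (by simp), ← lintegral_const_mul' _ _ (by simp),
        ← lintegral_add_left' (m1.const_mul 2)]
      refine lintegral_mono fun x => ?_
      have : f x - g x = -(F (x, y) - f x) + (F (x, y) - g x) := by ring
      rw [this]
      refine (pow_le_pow_left' (enorm_add_le _ _) 2).trans ?_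
      rw [enorm_neg]
      exact ENNReal.add_sq_le_two_mul _ _
    have hlim := (ENNReal.Tendsto.const_mul (hf.2 n) (Or.inr (by simp : (2 : ℝ≥0∞) ≠ ⊤))).add
      (ENNReal.Tendsto.const_mul (hg.2 n) (Or.inr (by simp : (2 : ℝ≥0∞) ≠ ⊤)))
    have h0 := ge_of_tendsto hlim hle
    simp only [mul_zero, add_zero, nonpos_iff_eq_zero] at h0
    have h0 := (lintegral_eq_zero_iff' (((hf.1.sub hg.1).enorm.pow_const 2).restrict)).1 h0
    rw [← ae_restrict_iff' measurableSet_Icc]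
    filter_upwards [h0] with x hx
    simpa [sub_eq_zero] using hx
  filter_upwards [ae_all_iff.2 key] with x hx
  obtain ⟨n, hn⟩ := exists_nat_ge |x|
  exact hx n (abs_le.1 hn)

theorem IsTrace.congr {F : ℝ × ℝ → ℂ} {f g : ℝ → ℂ} (hf : IsTrace F f) (h : g =ᵐ[volume] f) :
    IsTrace F g := by
  refine ⟨hf.1.congr h.symm, fun R => (hf.2 R).congr fun y => ?_⟩
  refine lintegral_congr_ae (ae_restrict_of_ae (h.mono fun x hx => ?_))
  simp only [hx]

theorem IsTrace.add {F F' : ℝ × ℝ → ℂ} (hF : AEStronglyMeasurable F volume) {f f' : ℝ → ℂ}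
    (hf : IsTrace F f) (hf' : IsTrace F' f') : IsTrace (F + F') (f + f') := by
  refine ⟨hf.1.add hf'.1, fun R => ?_⟩
  have hlim := (ENNReal.Tendsto.const_mul (hf.2 R) (Or.inr (by simp : (2 : ℝ≥0∞) ≠ ⊤))).add
    (ENNReal.Tendsto.const_mul (hf'.2 R) (Or.inr (by simp : (2 : ℝ≥0∞) ≠ ⊤)))
  simp only [mul_zero, add_zero] at hlim
  refine tendsto_of_tendsto_of_tendsto_of_le_of_le' tendsto_const_nhds hlim
    (Eventually.of_forall fun _ => zero_le) (Eventually.filter_mono inf_le_left ?_)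
  filter_upwards [ae_aestronglyMeasurable_slice hF] with y hy
  have m1 : AEMeasurable (fun x => ‖F (x, y) - f x‖ₑ ^ 2) (volume.restrict (Icc (-R) R)) :=
    ((hy.sub hf.1).enorm.pow_const 2).restrict
  rw [← lintegral_const_mul' _ _ (by simp), ← lintegral_const_mul' _ _ (by simp),
    ← lintegral_add_left' (m1.const_mul 2)]
  refine lintegral_mono fun x => ?_
  have : (F + F') (x, y) - (f + f') x = (F (x, y) - f x) + (F' (x, y) - f' x) := by
    simp only [Pi.add_apply]; ring
  rw [this]
  exact (pow_le_pow_left' (enorm_add_le _ _) 2).trans (ENNReal.add_sq_le_two_mul _ _)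

theorem IsTrace.const_smul {F : ℝ × ℝ → ℂ} {f : ℝ → ℂ} (hf : IsTrace F f) (a : ℂ) :
    IsTrace (a • F) (a • f) := by
  refine ⟨hf.1.const_smul a, fun R => ?_⟩
  have hlim := ENNReal.Tendsto.const_mul (a := ‖a‖ₑ ^ 2) (hf.2 R) (Or.inr (by simp))
  rw [mul_zero] at hlim
  refine hlim.congr fun y => ?_
  rw [← lintegral_const_mul' _ _ (by simp)]
  refine lintegral_congr fun x => ?_
  rw [Pi.smul_apply, Pi.smul_apply, ← smul_sub, enorm_smul, mul_pow]

theorem tendsto_enorm_mul_const {A : ℝ≥0∞} (hA : A ≠ ⊤) :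
    Tendsto (fun y : ℝ => ‖y‖ₑ * A) (𝓝 0) (𝓝 0) := by
  have := ENNReal.Tendsto.mul_const (b := A) ((continuous_id (X := ℝ)).enorm.tendsto 0)
    (Or.inr hA)
  simpa using this

theorem isTrace_of_ae_le {F : ℝ × ℝ → ℂ} {f : ℝ → ℂ} (hf : AEStronglyMeasurable f volume)
    {A : ℝ≥0∞} (hA : A ≠ ⊤) (h : ∀ᵐ y : ℝ, ∫⁻ x, ‖F (x, y) - f x‖ₑ ^ 2 ≤ ‖y‖ₑ * A) :
    IsTrace F f := by
  refine ⟨hf, fun R => ?_⟩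
  have hlim := tendsto_enorm_mul_const hA
  refine tendsto_of_tendsto_of_tendsto_of_le_of_le' tendsto_const_nhds
    (hlim.mono_left inf_le_right)
    (Eventually.of_forall fun _ => zero_le) (Eventually.filter_mono inf_le_left ?_)
  filter_upwards [h] with y hy
  exact (setLIntegral_le_lintegral _ _).trans hy

theorem isTrace_of_continuous {F : ℝ × ℝ → ℂ} (hF : Continuous F) :
    IsTrace F fun x => F (x, 0) := by
  refine ⟨(by fun_prop : Continuous fun x => F (x, 0)).aestronglyMeasurable, fun R => ?_⟩
  refine Tendsto.mono_left ?_ inf_le_right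
  have hc : Continuous fun y : ℝ => ∫ x in Icc (-R) R, ‖F (x, y) - F (x, 0)‖ ^ 2 :=
    continuous_parametric_integral_of_continuous
      (f := fun y x => ‖F (x, y) - F (x, 0)‖ ^ 2) (by fun_prop) isCompact_Icc
  have := ENNReal.tendsto_ofReal (hc.tendsto 0)
  simp only [sub_self, norm_zero, ne_eq, OfNat.ofNat_ne_zero, not_false_eq_true, zero_pow,
    integral_zero, ENNReal.ofReal_zero] at this
  refine this.congr fun y => ?_
  rw [ofReal_integral_eq_lintegral_ofReal _ (ae_of_all _ fun x => by positivity)]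
  · refine lintegral_congr fun x => ?_
    rw [ENNReal.ofReal_pow (norm_nonneg _), ofReal_norm]
  · have : Continuous fun x => ‖F (x, y) - F (x, 0)‖ ^ 2 := by fun_prop
    exact this.continuousOn.integrableOn_Icc

/-! ### Existence of the trace -/

/-- The estimates for smooth functions pass to almost every slice of a function of finite
energy. -/
theorem exists_ae_slice_estimates {F : ℝ × ℝ → ℂ} (hF : LocallyIntegrable F) {G : L2Field}
    (hG : IsWeakGrad F G) :
    ∃ S : Set ℝ, (∀ᵐ y, y ∈ S) ∧ ∀ y ∈ S, AEStronglyMeasurable (fun x => F (x, y)) volume ∧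
      ∫⁻ p, ‖diffQuot (fun x => F (x, y)) p‖ₑ ^ 2 ≤
        64 * ((∫⁻ p, ‖G.fst p‖ₑ ^ 2) + ∫⁻ p, ‖G.snd p‖ₑ ^ 2) ∧
      ∀ y' ∈ S, ∫⁻ x, ‖F (x, y') - F (x, y)‖ₑ ^ 2 ≤ ‖y' - y‖ₑ * ∫⁻ p, ‖G.snd p‖ₑ ^ 2 := by
  obtain ⟨u, hu, h1, h2, hlim⟩ := exists_contDiff_approx hF hG
  have hm : ∀ n y, AEStronglyMeasurable (fun x => u n (x, y)) volume := fun n y =>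
    ((hu n).continuous.comp (by fun_prop)).aestronglyMeasurable
  refine ⟨{y | ∀ᵐ x, Tendsto (fun n => u n (x, y)) atTop (𝓝 (F (x, y)))}, ?_, fun y hy =>
    ⟨?_, ?_, fun y' hy' => ?_⟩⟩
  · exact Measure.ae_ae_of_ae_prod
      (Measure.measurePreserving_swap.quasiMeasurePreserving.ae hlim)
  · exact aestronglyMeasurable_of_tendsto_ae atTop (fun n => hm n y) hy
  · refine lintegral_diffQuot_sq_le_of_tendsto (fun n => hm n y) hy fun n => ?_
    refine (lintegral_diffQuot_slice_le_of_contDiff (hu n) y).trans ?_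
    exact mul_le_mul_right (add_le_add (h1 n) (h2 n)) _
  · refine lintegral_enorm_sq_le_of_tendsto (fun n => (hm n y').sub (hm n y)) ?_ (fun n => ?_)
      tendsto_const_nhds
    · filter_upwards [hy, hy'] with x a b using b.sub a
    · refine (lintegral_sub_sq_le_of_contDiff (hu n) y y').trans ?_
      exact mul_le_mul_right (h2 n) _

/-- A function of finite energy has a trace: along a sequence of levels tending to `0` fast enough,
the slices converge almost everywhere, and Fatou's lemma carries the estimates to the limit. -/
theorem exists_trace {F : ℝ × ℝ → ℂ} (hF : LocallyIntegrable F) {G : L2Field}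
    (hG : IsWeakGrad F G) :
    ∃ f : ℝ → ℂ, IsTrace F f ∧ ∫⁻ p, ‖diffQuot f p‖ₑ ^ 2 ≤
        64 * ((∫⁻ p, ‖G.fst p‖ₑ ^ 2) + ∫⁻ p, ‖G.snd p‖ₑ ^ 2) := by
  obtain ⟨S, hS, h⟩ := exists_ae_slice_estimates hF hG
  set A := ∫⁻ p, ‖G.snd p‖ₑ ^ 2 with hA
  have hAt : A ≠ ⊤ := by
    rw [hA, ← ofReal_norm_sq_eq_lintegral]; exact ENNReal.ofReal_ne_top
  have hlim := tendsto_enorm_mul_const hAt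
  -- The levels are chosen so that `‖F(·, yₙ) - F(·, yₘ)‖² < 4⁻ᴺ` for `n, m ≥ N`, which is summable
  -- after taking square roots.
  have hex : ∀ k : ℕ, ∃ y, y ∈ S ∧ ‖y‖ₑ * A < 2⁻¹ * (2⁻¹ ^ k) ^ 2 ∧ |y| < 1 / ((k : ℝ) + 1) := by
    intro k
    have hpos : (0 : ℝ≥0∞) < 2⁻¹ * (2⁻¹ ^ k) ^ 2 := by
      have h2 : (2⁻¹ : ℝ≥0∞) ≠ 0 := by simp
      exact pos_iff_ne_zero.2 (mul_ne_zero h2 (pow_ne_zero _ (pow_ne_zero _ h2)))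
    have h1 : ∀ᶠ y in ae volume ⊓ 𝓝 (0 : ℝ), y ∈ S := Eventually.filter_mono inf_le_left hS
    have h2 : ∀ᶠ y in ae volume ⊓ 𝓝 (0 : ℝ), ‖y‖ₑ * A < 2⁻¹ * (2⁻¹ ^ k) ^ 2 :=
      Eventually.filter_mono inf_le_right (hlim.eventually_lt_const hpos)
    have h3 : ∀ᶠ y in ae volume ⊓ 𝓝 (0 : ℝ), |y| < 1 / ((k : ℝ) + 1) := by
      refine Eventually.filter_mono inf_le_right ?_
      refine (continuous_abs.tendsto (0 : ℝ)).eventually_lt_const ?_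
      rw [abs_zero]; positivity
    exact (h1.and (h2.and h3)).exists
  choose y hyS hyA hy using hex
  have hy0 : Tendsto y atTop (𝓝 0) :=
    squeeze_zero_norm (fun k => (hy k).le) tendsto_one_div_add_atTop_nhds_zero_nat
  have hm : ∀ k, AEStronglyMeasurable (fun x => F (x, y k)) volume := fun k => (h _ (hyS k)).1
  have hanti : ∀ N n : ℕ, N ≤ n → (2⁻¹ * (2⁻¹ ^ n) ^ 2 : ℝ≥0∞) ≤ 2⁻¹ * (2⁻¹ ^ N) ^ 2 := by
    intro N n hn
    gcongr 2⁻¹ * ?_ ^ 2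
    exact pow_le_pow_right_of_le_one' (by simp) hn
  have hcau : ∀ᵐ x, ∃ l : ℂ, Tendsto (fun k => F (x, y k)) atTop (𝓝 l) := by
    refine Lp.ae_tendsto_of_cauchy_eLpNorm (p := 2) (f := fun k x => F (x, y k))
      (B := fun N => 2⁻¹ ^ N) hm (by norm_num) ?_ ?_
    · rw [ENNReal.tsum_geometric, ENNReal.one_sub_inv_two, inv_inv]
      norm_num
    · intro N n m hn hm'
      have e : eLpNorm ((fun x => F (x, y n)) - fun x => F (x, y m)) 2 volume ^ 2
          = ∫⁻ x, ‖F (x, y n) - F (x, y m)‖ₑ ^ 2 := by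
        rw [eLpNorm_eq_lintegral_rpow_enorm_toReal (by norm_num) (by norm_num),
          ← ENNReal.rpow_mul_natCast]
        simp
      refine (ENNReal.pow_right_strictMono two_ne_zero).lt_iff_lt.1 ?_
      refine (e.le.trans ((h _ (hyS m)).2.2 _ (hyS n))).trans_lt ?_
      calc ‖y n - y m‖ₑ * A ≤ (‖y n‖ₑ + ‖y m‖ₑ) * A := by
            gcongr; exact enorm_sub_le
        _ = ‖y n‖ₑ * A + ‖y m‖ₑ * A := add_mul _ _ _
        _ < 2⁻¹ * (2⁻¹ ^ n) ^ 2 + 2⁻¹ * (2⁻¹ ^ m) ^ 2 := ENNReal.add_lt_add (hyA n) (hyA m)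
        _ ≤ 2⁻¹ * (2⁻¹ ^ N) ^ 2 + 2⁻¹ * (2⁻¹ ^ N) ^ 2 := by
            gcongr ?_ + ?_
            · exact hanti N n hn
            · exact hanti N m hm'
        _ = (2⁻¹ ^ N) ^ 2 := by rw [← add_mul, ENNReal.inv_two_add_inv_two, one_mul]
  obtain ⟨f, hf, hfl⟩ := exists_stronglyMeasurable_limit_of_tendsto_ae hm hcau
  refine ⟨f, isTrace_of_ae_le hf.aestronglyMeasurable hAt ?_, ?_⟩
  · filter_upwards [hS] with z hz
    refine lintegral_enorm_sq_le_of_tendsto (u := fun k x => F (x, z) - F (x, y k))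
      (fun k => (h z hz).1.sub (hm k)) (hfl.mono fun x hx => tendsto_const_nhds.sub hx)
      (fun k => (h _ (hyS k)).2.2 z hz) ?_
    have h1 : Tendsto (fun k => ‖z - y k‖ₑ) atTop (𝓝 ‖z - 0‖ₑ) :=
      (tendsto_const_nhds.sub hy0).enorm
    rw [sub_zero] at h1
    exact ENNReal.Tendsto.mul_const h1 (Or.inr hAt)
  · exact lintegral_diffQuot_sq_le_of_tendsto hm hfl fun k => (h _ (hyS k)).2.1

/-! ### The Poisson kernel of the half plane -/

/-- The Poisson kernel `|y| / (π ((x - u)² + y²))` of both half planes. -/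
noncomputable def poissonKer (x y u : ℝ) : ℝ := |y| / Real.pi * ((x - u) ^ 2 + y ^ 2)⁻¹

/-- The derivative of the Poisson kernel in `x`. -/
noncomputable def poissonKerDx (x y u : ℝ) : ℝ :=
  |y| / Real.pi * (-(2 * (x - u)) / ((x - u) ^ 2 + y ^ 2) ^ 2)

/-- The derivative of the Poisson kernel in `y ≠ 0`. -/
noncomputable def poissonKerDy (x y u : ℝ) : ℝ :=
  SignType.sign y / Real.pi * (((x - u) ^ 2 - y ^ 2) / ((x - u) ^ 2 + y ^ 2) ^ 2)

theorem sq_add_sq_pos (t : ℝ) {y : ℝ} (hy : y ≠ 0) : 0 < t ^ 2 + y ^ 2 := by positivity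

theorem hasDerivAt_poissonKer_x {y : ℝ} (hy : y ≠ 0) (x u : ℝ) :
    HasDerivAt (fun x => poissonKer x y u) (poissonKerDx x y u) x := by
  have h1 : HasDerivAt (fun x : ℝ => (x - u) ^ 2 + y ^ 2) (2 * (x - u)) x := by
    simpa using (((hasDerivAt_id x).sub_const u).pow 2).add_const (y ^ 2)
  exact (h1.fun_inv (sq_add_sq_pos (x - u) hy).ne').const_mul (|y| / Real.pi)

theorem hasDerivAt_poissonKer_y {y : ℝ} (hy : y ≠ 0) (x u : ℝ) :
    HasDerivAt (fun y => poissonKer x y u) (poissonKerDy x y u) y := by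
  have h1 : HasDerivAt (fun y : ℝ => (x - u) ^ 2 + y ^ 2) (2 * y) y := by
    simpa using ((hasDerivAt_id y).pow 2).const_add ((x - u) ^ 2)
  have h2 := ((hasDerivAt_abs hy).div_const Real.pi).mul
    (h1.fun_inv (sq_add_sq_pos (x - u) hy).ne')
  refine h2.congr_deriv ?_
  have h3 : |y| = SignType.sign y * y := by rw [sign_mul_self]
  have := (sq_add_sq_pos (x - u) hy).ne'
  rw [poissonKerDy, h3]
  field_simp
  ring

theorem abs_poissonKerDx_le (x y u : ℝ) : |poissonKerDx x y u| ≤ ((x - u) ^ 2 + y ^ 2)⁻¹ := by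
  have h : |poissonKerDx x y u| = (2 * |x - u| * |y|) / ((x - u) ^ 2 + y ^ 2) ^ 2 / Real.pi := by
    rw [poissonKerDx, abs_mul, abs_div, abs_div, abs_neg, abs_mul, abs_abs, abs_two,
      abs_of_pos Real.pi_pos, abs_of_nonneg (by positivity : 0 ≤ ((x - u) ^ 2 + y ^ 2) ^ 2)]
    ring
  rw [h]
  refine (div_le_self (by positivity) (by linarith [Real.pi_gt_three])).trans ?_
  rcases eq_or_lt_of_le (by positivity : 0 ≤ (x - u) ^ 2 + y ^ 2) with h0 | h0
  · rw [← h0]; simp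
  rw [div_le_iff₀ (by positivity), sq ((x - u) ^ 2 + y ^ 2), inv_mul_cancel_left₀ h0.ne']
  nlinarith [sq_nonneg (|x - u| - |y|), sq_abs (x - u), sq_abs y]

theorem abs_poissonKerDy_le (x y u : ℝ) : |poissonKerDy x y u| ≤ ((x - u) ^ 2 + y ^ 2)⁻¹ := by
  have hs : |((SignType.sign y : SignType) : ℝ)| ≤ 1 := by
    rcases lt_trichotomy y 0 with h | h | h <;> simp [h]
  have h : |poissonKerDy x y u| ≤ |(x - u) ^ 2 - y ^ 2| / ((x - u) ^ 2 + y ^ 2) ^ 2 := by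
    rw [poissonKerDy, abs_mul, abs_div, abs_div, abs_of_pos Real.pi_pos,
      abs_of_nonneg (by positivity : 0 ≤ ((x - u) ^ 2 + y ^ 2) ^ 2)]
    refine mul_le_of_le_one_left (by positivity) ?_
    exact (div_le_one Real.pi_pos).2 (hs.trans (by linarith [Real.pi_gt_three]))
  refine h.trans ?_
  rcases eq_or_lt_of_le (by positivity : 0 ≤ (x - u) ^ 2 + y ^ 2) with h0 | h0
  · rw [← h0]; simp
  rw [div_le_iff₀ (by positivity), sq ((x - u) ^ 2 + y ^ 2), inv_mul_cancel_left₀ h0.ne']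
  exact abs_le.2 ⟨by nlinarith [sq_nonneg (x - u)], by nlinarith [sq_nonneg y]⟩

theorem inv_sq_add_sq_le {x y r δ : ℝ} (hδ : 0 < δ) (hx : |x| ≤ r) (hy : δ ≤ |y|) (u : ℝ) :
    ((x - u) ^ 2 + y ^ 2)⁻¹ ≤ (2 + (1 + 2 * r ^ 2) / δ ^ 2) * (1 + u ^ 2)⁻¹ := by
  have hy2 : δ ^ 2 ≤ y ^ 2 := by rw [← sq_abs y]; gcongr
  have hx2 : x ^ 2 ≤ r ^ 2 := by rw [← sq_abs x]; gcongr
  have h0 : 0 < (x - u) ^ 2 + y ^ 2 := by nlinarith [sq_nonneg (x - u), pow_pos hδ 2]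
  rw [← div_eq_mul_inv, le_div_iff₀ (by positivity), inv_mul_le_iff₀ h0]
  have h1 : 1 + 2 * r ^ 2 ≤ (1 + 2 * r ^ 2) / δ ^ 2 * y ^ 2 := by
    rw [div_mul_eq_mul_div, le_div_iff₀ (by positivity)]
    gcongr
  have h2 : 0 ≤ (1 + 2 * r ^ 2) / δ ^ 2 * (x - u) ^ 2 := by positivity
  nlinarith [sq_nonneg (x + (x - u)), sq_nonneg y]

theorem integral_poissonKer (x : ℝ) {y : ℝ} (hy : y ≠ 0) : ∫ u, poissonKer x y u = 1 := by
  have h1 : ∫ u, poissonKer x y u = ∫ t : ℝ, |y| / Real.pi * (t ^ 2 + y ^ 2)⁻¹ :=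
    integral_sub_left_eq_self (fun t => |y| / Real.pi * (t ^ 2 + y ^ 2)⁻¹) volume x
  have h2 := Measure.integral_comp_mul_left (fun t : ℝ => |y| / Real.pi * (t ^ 2 + y ^ 2)⁻¹) y
  have h3 : ∀ s : ℝ, |y| / Real.pi * ((y * s) ^ 2 + y ^ 2)⁻¹
      = |y⁻¹| / Real.pi * (1 + s ^ 2)⁻¹ := by
    intro s
    have : (y * s) ^ 2 + y ^ 2 = |y| ^ 2 * (1 + s ^ 2) := by rw [sq_abs]; ring
    have hy' := abs_ne_zero.2 hy
    have : 1 + s ^ 2 ≠ 0 := by positivity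
    rw [‹(y * s) ^ 2 + y ^ 2 = _›, abs_inv]
    field_simp
  simp only [h3, integral_const_mul, integral_univ_inv_one_add_sq, smul_eq_mul] at h2
  rw [h1, integral_const_mul]
  have hy' := abs_ne_zero.2 hy
  rw [div_mul_cancel₀ _ Real.pi_ne_zero] at h2
  exact (mul_left_cancel₀ (abs_ne_zero.2 (inv_ne_zero hy)) ((mul_one _).trans h2)).symm

theorem continuous_poissonKer {y : ℝ} (hy : y ≠ 0) (x : ℝ) : Continuous (poissonKer x y) := by
  unfold poissonKer
  exact continuous_const.mul
    (Continuous.inv₀ (by fun_prop) fun u => (sq_add_sq_pos (x - u) hy).ne')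

theorem abs_poissonKer_le (x y u : ℝ) : |poissonKer x y u| ≤ |y| * ((x - u) ^ 2 + y ^ 2)⁻¹ := by
  have h : 0 ≤ ((x - u) ^ 2 + y ^ 2)⁻¹ := by positivity
  rw [poissonKer, abs_of_nonneg (by positivity)]
  gcongr
  exact div_le_self (abs_nonneg y) (by linarith [Real.pi_gt_three])

theorem measurable_poissonKer :
    Measurable fun q : (ℝ × ℝ) × ℝ => poissonKer q.1.1 q.1.2 q.2 := by
  unfold poissonKer; fun_prop

theorem measurable_poissonKerDx :
    Measurable fun q : (ℝ × ℝ) × ℝ => poissonKerDx q.1.1 q.1.2 q.2 := by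
  unfold poissonKerDx; fun_prop

theorem measurable_poissonKerDy :
    Measurable fun q : (ℝ × ℝ) × ℝ => poissonKerDy q.1.1 q.1.2 q.2 := by
  have hs : Measurable fun y : ℝ => ((SignType.sign y : SignType) : ℝ) := by
    have : (fun y : ℝ => ((SignType.sign y : SignType) : ℝ)) =
        fun y => if 0 < y then 1 else if y < 0 then -1 else 0 := by
      ext y
      rw [sign_apply]
      split_ifs <;> simp
    rw [this]
    exact Measurable.ite measurableSet_Ioi measurable_const
      (Measurable.ite measurableSet_Iio measurable_const measurable_const)
  have h : Measurable fun q : (ℝ × ℝ) × ℝ => ((SignType.sign q.1.2 : SignType) : ℝ) :=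
    hs.comp (by fun_prop)
  unfold poissonKerDy
  fun_prop

/-- Integrability against the weight `1 / (1 + u²)`: the functions that have a Poisson integral. -/
def PoissonIntegrable (f : ℝ → ℂ) : Prop := Integrable fun u => ((1 + u ^ 2)⁻¹ : ℝ) • f u

theorem PoissonIntegrable.const (c : ℂ) : PoissonIntegrable fun _ => c :=
  integrable_inv_one_add_sq.smul_const c

theorem PoissonIntegrable.aestronglyMeasurable {f : ℝ → ℂ} (hf : PoissonIntegrable f) :
    AEStronglyMeasurable f volume := by
  have h : AEStronglyMeasurable (fun u : ℝ => (1 + u ^ 2 : ℝ)) volume :=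
    (by fun_prop : Continuous fun u : ℝ => (1 + u ^ 2 : ℝ)).aestronglyMeasurable
  refine (h.smul (Integrable.aestronglyMeasurable hf)).congr (ae_of_all _ fun u => ?_)
  have : (1 + u ^ 2 : ℝ) ≠ 0 := by positivity
  simp only [Pi.smul_apply', smul_smul, mul_inv_cancel₀ this, one_smul]

theorem PoissonIntegrable.integrable_smul {f : ℝ → ℂ} (hf : PoissonIntegrable f) {k : ℝ → ℝ}
    (hk : AEStronglyMeasurable k volume) {C : ℝ} (h : ∀ u, |k u| ≤ C * (1 + u ^ 2)⁻¹) :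
    Integrable fun u => k u • f u := by
  refine Integrable.mono' ((Integrable.norm hf).const_mul C) (hk.smul hf.aestronglyMeasurable)
    (ae_of_all _ fun u => ?_)
  rw [norm_smul, norm_smul, ← mul_assoc, Real.norm_eq_abs,
    Real.norm_of_nonneg (by positivity : 0 ≤ (1 + u ^ 2)⁻¹)]
  exact mul_le_mul_of_nonneg_right (h u) (norm_nonneg _)

theorem PoissonIntegrable.integrable_poissonKer {f : ℝ → ℂ} (hf : PoissonIntegrable f) (x : ℝ)
    {y : ℝ} (hy : y ≠ 0) : Integrable fun u => poissonKer x y u • f u := by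
  refine hf.integrable_smul (continuous_poissonKer hy x).aestronglyMeasurable
    (C := |y| * (2 + (1 + 2 * |x| ^ 2) / |y| ^ 2)) fun u => (abs_poissonKer_le x y u).trans ?_
  rw [mul_assoc]
  exact mul_le_mul_of_nonneg_left (inv_sq_add_sq_le (abs_pos.2 hy) le_rfl le_rfl u) (abs_nonneg y)

theorem PoissonIntegrable.hasDerivAt_x {f : ℝ → ℂ} (hf : PoissonIntegrable f) (x : ℝ) {y : ℝ}
    (hy : y ≠ 0) : Integrable (fun u => poissonKerDx x y u • f u) ∧
      HasDerivAt (fun x => ∫ u, poissonKer x y u • f u) (∫ u, poissonKerDx x y u • f u) x := by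
  refine hasDerivAt_integral_of_dominated_loc_of_deriv_le (Metric.ball_mem_nhds x one_pos)
    (bound := fun u => (2 + (1 + 2 * (|x| + 1) ^ 2) / |y| ^ 2) * ‖((1 + u ^ 2)⁻¹ : ℝ) • f u‖)
    (Eventually.of_forall fun x' => (hf.integrable_poissonKer x' hy).aestronglyMeasurable)
    (hf.integrable_poissonKer x hy) ?_ (ae_of_all _ fun u x' hx' => ?_)
    ((Integrable.norm hf).const_mul _)
    (ae_of_all _ fun u x' _ => (hasDerivAt_poissonKer_x hy x' u).smul_const (f u))
  · exact (measurable_poissonKerDx.comp (measurable_prodMk_left (x := (x, y))))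
      |>.aestronglyMeasurable.smul hf.aestronglyMeasurable
  · have hx : |x'| ≤ |x| + 1 := by
      have h1 : |x' - x| < 1 := by simpa [Real.dist_eq] using hx'
      have := abs_sub_abs_le_abs_sub x' x
      linarith
    rw [norm_smul, norm_smul, ← mul_assoc, Real.norm_eq_abs,
      Real.norm_of_nonneg (by positivity : 0 ≤ (1 + u ^ 2)⁻¹)]
    exact mul_le_mul_of_nonneg_right ((abs_poissonKerDx_le x' y u).trans
      (inv_sq_add_sq_le (abs_pos.2 hy) hx le_rfl u)) (norm_nonneg _)

theorem PoissonIntegrable.hasDerivAt_y {f : ℝ → ℂ} (hf : PoissonIntegrable f) (x : ℝ) {y : ℝ}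
    (hy : y ≠ 0) : Integrable (fun u => poissonKerDy x y u • f u) ∧
      HasDerivAt (fun y => ∫ u, poissonKer x y u • f u) (∫ u, poissonKerDy x y u • f u) y := by
  have hy2 : 0 < |y| / 2 := by positivity
  have hball : ∀ y' ∈ Metric.ball y (|y| / 2), |y| / 2 ≤ |y'| := by
    intro y' hy'
    have h1 : |y' - y| < |y| / 2 := by simpa [Real.dist_eq] using hy'
    have := abs_sub_abs_le_abs_sub y y'
    rw [abs_sub_comm] at h1
    linarith
  have hne : ∀ y' ∈ Metric.ball y (|y| / 2), y' ≠ 0 := fun y' hy' =>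
    abs_pos.1 (hy2.trans_le (hball y' hy'))
  refine hasDerivAt_integral_of_dominated_loc_of_deriv_le (Metric.ball_mem_nhds y hy2)
    (bound := fun u => (2 + (1 + 2 * |x| ^ 2) / (|y| / 2) ^ 2) * ‖((1 + u ^ 2)⁻¹ : ℝ) • f u‖)
    ?_ (hf.integrable_poissonKer x hy) ?_ (ae_of_all _ fun u y' hy' => ?_)
    ((Integrable.norm hf).const_mul _)
    (ae_of_all _ fun u y' hy' => (hasDerivAt_poissonKer_y (hne y' hy') x u).smul_const (f u))
  · filter_upwards [Metric.ball_mem_nhds y hy2] with y' hy'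
    exact (hf.integrable_poissonKer x (hne y' hy')).aestronglyMeasurable
  · exact (measurable_poissonKerDy.comp (measurable_prodMk_left (x := (x, y))))
      |>.aestronglyMeasurable.smul hf.aestronglyMeasurable
  · rw [norm_smul, norm_smul, ← mul_assoc, Real.norm_eq_abs,
      Real.norm_of_nonneg (by positivity : 0 ≤ (1 + u ^ 2)⁻¹)]
    exact mul_le_mul_of_nonneg_right ((abs_poissonKerDy_le x y' u).trans
      (inv_sq_add_sq_le hy2 le_rfl (hball y' hy') u)) (norm_nonneg _)

theorem integral_poissonKer_smul_const (c : ℂ) (x : ℝ) {y : ℝ} (hy : y ≠ 0) :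
    ∫ u, poissonKer x y u • c = c := by
  rw [integral_smul_const, integral_poissonKer x hy, one_smul]

/-- The Poisson integral of a constant is that constant, so the derivatives of the kernel have mean
zero. -/
theorem integral_poissonKerDx_smul_const (c : ℂ) (x : ℝ) {y : ℝ} (hy : y ≠ 0) :
    ∫ u, poissonKerDx x y u • c = 0 := by
  refine ((PoissonIntegrable.const c).hasDerivAt_x x hy).2.unique ?_
  simp only [integral_poissonKer_smul_const c _ hy]
  exact hasDerivAt_const x c

theorem integral_poissonKerDy_smul_const (c : ℂ) (x : ℝ) {y : ℝ} (hy : y ≠ 0) :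
    ∫ u, poissonKerDy x y u • c = 0 := by
  refine ((PoissonIntegrable.const c).hasDerivAt_y x hy).2.unique ?_
  refine (hasDerivAt_const y c).congr_of_eventuallyEq ?_
  filter_upwards [isOpen_ne.mem_nhds hy] with y' hy'
  exact integral_poissonKer_smul_const c x hy'

/-- The Poisson integral at every point, the axis `y = 0` included, where both sides vanish. -/
theorem poissonExtension_eq (f : ℝ → ℂ) (x y : ℝ) :
    poissonExtension f (x, y) = ∫ u, poissonKer x y u • f u := by
  rw [← integral_sub_left_eq_self (fun u => poissonKer x y u • f u) volume x, poissonExtension,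
    ← integral_const_mul]
  refine integral_congr_ae (ae_of_all _ fun t => ?_)
  simp only [poissonKer, sub_sub_cancel, Complex.real_smul]
  push_cast
  ring

/-! ### Estimates for the Poisson integral -/

theorem ae_memLp_diffQuot {f : ℝ → ℂ} (hf : f ∈ halfFunctions) :
    ∀ᵐ x, MemLp (fun u => diffQuot f (x, u)) 2 volume := by
  have hd := hf.2
  have h := hd.lintegral_enorm_sq_lt_top
  rw [Measure.volume_eq_prod, lintegral_prod _ (hd.1.enorm.pow_const 2)] at h
  have ht := ae_lt_top' ((hd.1.enorm.pow_const 2).lintegral_prod_right') h.ne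
  filter_upwards [ht, hd.1.prodMk_left] with x hx hm
  exact memLp_two_of_lintegral_lt_top hm hx

theorem aestronglyMeasurable_of_mem_halfFunctions {f : ℝ → ℂ} (hf : f ∈ halfFunctions) :
    AEStronglyMeasurable f volume := by
  obtain ⟨x, hx⟩ := (ae_memLp_diffQuot hf).exists
  have hm : AEStronglyMeasurable (fun u => ((x - u : ℝ) : ℂ)) volume :=
    (by fun_prop : Continuous fun u => ((x - u : ℝ) : ℂ)).aestronglyMeasurable
  refine ((aestronglyMeasurable_const (b := f x)).sub (hm.mul hx.1)).congr (ae_of_all _ fun u => ?_)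
  simp only [Pi.sub_apply, Pi.mul_apply, ← sub_eq_mul_diffQuot, sub_sub_cancel]

theorem enorm_sub_eq_mul_diffQuot (f : ℝ → ℂ) (x u : ℝ) :
    ‖f u - f x‖ₑ = ‖x - u‖ₑ * ‖diffQuot f (x, u)‖ₑ := by
  rw [← enorm_neg, neg_sub, sub_eq_mul_diffQuot, enorm_mul]
  congr 1
  rw [← ofReal_norm, ← ofReal_norm, Complex.norm_real]

/-- The Poisson integral converges absolutely: `f(u) = f(x) - (x - u) q(u)` where, for almost every
`x`, the difference quotient `q` is square integrable. -/
theorem poissonIntegrable_of_mem_halfFunctions {f : ℝ → ℂ} (hf : f ∈ halfFunctions) :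
    PoissonIntegrable f := by
  obtain ⟨x, hx⟩ := (ae_memLp_diffQuot hf).exists
  have hk : MemLp (fun u : ℝ => (1 + u ^ 2)⁻¹ * (x - u)) 2 volume := by
    have hc : Continuous fun u : ℝ => (1 + u ^ 2)⁻¹ * (x - u) :=
      (Continuous.inv₀ (by fun_prop) fun u => by positivity).mul (by fun_prop)
    refine (memLp_two_iff_integrable_sq hc.aestronglyMeasurable).2 ?_
    refine Integrable.mono' (integrable_inv_one_add_sq.const_mul (2 * (1 + x ^ 2)))
      (hc.pow 2).aestronglyMeasurable (ae_of_all _ fun u => ?_)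
    have h0 : (0 : ℝ) < 1 + u ^ 2 := by positivity
    rw [Real.norm_of_nonneg (by positivity), mul_pow, sq (1 + u ^ 2)⁻¹, mul_assoc, mul_comm]
    refine mul_le_mul_of_nonneg_right ?_ (by positivity)
    rw [inv_mul_le_iff₀ h0]
    nlinarith [sq_nonneg (x + u), sq_nonneg (x * u)]
  have h2 : Integrable fun u => ((1 + u ^ 2)⁻¹ * (x - u)) • diffQuot f (x, u) :=
    memLp_one_iff_integrable.1 (hx.smul (p := 2) (q := 2) (r := 1) hk)
  refine ((PoissonIntegrable.const (f x)).sub h2).congr (ae_of_all _ fun u => ?_)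
  have := sub_eq_mul_diffQuot f x u
  simp only [mul_smul, Pi.sub_apply]
  rw [← smul_sub, Complex.real_smul (x := x - u), ← this, sub_sub_cancel]

/-- The Poisson integral takes its boundary values with the rate `|y|^{1/2}`. -/
theorem enorm_poissonExtension_sub_sq_le {f : ℝ → ℂ} (hf : Measurable f)
    (hi : PoissonIntegrable f) (x : ℝ) {y : ℝ} (hy : y ≠ 0) :
    ‖poissonExtension f (x, y) - f x‖ₑ ^ 2 ≤ ‖y‖ₑ * ∫⁻ u, ‖diffQuot f (x, u)‖ₑ ^ 2 := by
  have e : poissonExtension f (x, y) - f x = ∫ u, poissonKer x y u • (f u - f x) := by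
    simp only [smul_sub]
    rw [integral_sub (hi.integrable_poissonKer x hy)
      ((PoissonIntegrable.const (f x)).integrable_poissonKer x hy),
      integral_poissonKer_smul_const _ x hy, poissonExtension_eq]
  have hc := continuous_poissonKer hy x
  have hK : ∫⁻ u, ‖poissonKer x y u * (x - u)‖ₑ ^ 2 ≤ ‖y‖ₑ := by
    have hint : Integrable (poissonKer x y) := by
      by_contra h
      have := integral_undef h
      rw [integral_poissonKer x hy] at this
      exact one_ne_zero this
    have h0 : ∀ u, 0 ≤ poissonKer x y u := fun u => by unfold poissonKer; positivity
    calc ∫⁻ u, ‖poissonKer x y u * (x - u)‖ₑ ^ 2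
        ≤ ∫⁻ u, ENNReal.ofReal (|y| * poissonKer x y u) := by
          refine lintegral_mono fun u => ?_
          rw [← enorm_pow, Real.enorm_eq_ofReal (sq_nonneg _)]
          refine ENNReal.ofReal_le_ofReal ?_
          have hp := sq_add_sq_pos (x - u) hy
          have h1 : poissonKer x y u * (x - u) ^ 2 ≤ |y| := by
            have : (x - u) ^ 2 ≤ (x - u) ^ 2 + y ^ 2 := by nlinarith [sq_nonneg y]
            refine (mul_le_mul_of_nonneg_left this (h0 u)).trans ?_
            rw [poissonKer, mul_assoc, inv_mul_cancel₀ hp.ne', mul_one]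
            exact div_le_self (abs_nonneg y) (by linarith [Real.pi_gt_three])
          calc (poissonKer x y u * (x - u)) ^ 2
              = (poissonKer x y u * (x - u) ^ 2) * poissonKer x y u := by ring
            _ ≤ _ := mul_le_mul_of_nonneg_right h1 (h0 u)
      _ = ENNReal.ofReal |y| := by
          rw [← ofReal_integral_eq_lintegral_ofReal (hint.const_mul _)
            (ae_of_all _ fun u => mul_nonneg (abs_nonneg y) (h0 u)), integral_const_mul,
            integral_poissonKer x hy, mul_one]
      _ = ‖y‖ₑ := (Real.enorm_eq_ofReal_abs y).symm
  have hm : Measurable fun u => ‖diffQuot f (x, u)‖ₑ :=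
    ((measurable_diffQuot hf).comp measurable_prodMk_left).enorm
  have h1 : ‖∫ u, poissonKer x y u • (f u - f x)‖ₑ ≤
      ∫⁻ u, ‖poissonKer x y u * (x - u)‖ₑ * ‖diffQuot f (x, u)‖ₑ := by
    refine (enorm_integral_le_lintegral_enorm _).trans (le_of_eq (lintegral_congr fun u => ?_))
    rw [enorm_smul, enorm_sub_eq_mul_diffQuot, enorm_mul, mul_assoc]
  rw [e]
  refine (pow_le_pow_left' h1 2).trans ((sq_lintegral_mul_le _ ?_ hm.aemeasurable).trans ?_)
  · exact (hc.mul (by fun_prop)).enorm.aemeasurable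
  · exact mul_le_mul_left hK _

theorem lintegral_poissonExtension_sub_sq_le {f : ℝ → ℂ} (hf : Measurable f)
    (hi : PoissonIntegrable f) {y : ℝ} (hy : y ≠ 0) :
    ∫⁻ x, ‖poissonExtension f (x, y) - f x‖ₑ ^ 2 ≤ ‖y‖ₑ * ∫⁻ p, ‖diffQuot f p‖ₑ ^ 2 := by
  have hm : Measurable fun p => ‖diffQuot f p‖ₑ ^ 2 := (measurable_diffQuot hf).enorm.pow_const 2
  refine (lintegral_mono fun x => enorm_poissonExtension_sub_sq_le hf hi x hy).trans (le_of_eq ?_)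
  rw [lintegral_const_mul _ hm.lintegral_prod_right', Measure.volume_eq_prod,
    lintegral_prod _ hm.aemeasurable]

/-- The constant in the energy estimate for the Poisson integral. -/
noncomputable def poissonConst : ℝ≥0∞ :=
  (∫⁻ s : ℝ, ENNReal.ofReal (|s| ^ (1 / 2 : ℝ) * (1 + s ^ 2)⁻¹)) ^ 2

theorem poissonConst_lt_top : poissonConst < ⊤ := by
  have h : Integrable fun s : ℝ => (1 + ‖s‖ ^ 2) ^ (-(3 / 2 : ℝ) / 2) :=
    integrable_rpow_neg_one_add_norm_sq (by simp; norm_num)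
  refine ENNReal.pow_lt_top (lt_of_le_of_lt (lintegral_mono fun s => ?_)
    h.lintegral_lt_top)
  refine ENNReal.ofReal_le_ofReal ?_
  have h0 : 0 < 1 + ‖s‖ ^ 2 := by positivity
  have e1 : (1 + s ^ 2)⁻¹ = (1 + ‖s‖ ^ 2) ^ (-1 : ℝ) := by
    rw [Real.rpow_neg_one, Real.norm_eq_abs, sq_abs]
  -- The integrand is at most `(1 + s²) ^ (-3 / 4)`.
  have e2 : |s| ^ (1 / 2 : ℝ) ≤ (1 + ‖s‖ ^ 2) ^ (1 / 4 : ℝ) := by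
    have : |s| ^ (1 / 2 : ℝ) = (|s| ^ 2) ^ (1 / 4 : ℝ) := by
      rw [← Real.rpow_natCast_mul (abs_nonneg s)]; norm_num
    rw [this, Real.norm_eq_abs]
    exact Real.rpow_le_rpow (by positivity) (by linarith) (by norm_num)
  rw [e1]
  refine (mul_le_mul_of_nonneg_right e2 (by positivity)).trans (le_of_eq ?_)
  rw [← Real.rpow_add h0]
  norm_num

/-- The energy estimate: a kernel of size `1 / ((x - u)² + y²)` with mean zero maps `f` to a square
integrable function. In the variable `s = (u - x) / y` the integral is bounded by
`∫ |q(x, x + y s)| |s| / (1 + s²) ds` where `q` is the difference quotient of `f`. -/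
theorem lintegral_enorm_integral_sq_le {f : ℝ → ℂ} (hf : Measurable f) {k : ℝ → ℝ → ℝ → ℝ}
    (hk : ∀ x y u, |k x y u| ≤ ((x - u) ^ 2 + y ^ 2)⁻¹)
    (hi : ∀ x y, y ≠ 0 → Integrable fun u => k x y u • f u)
    (hc : ∀ (c : ℂ) x y, y ≠ 0 → Integrable fun u => k x y u • c)
    (h0 : ∀ (c : ℂ) x y, y ≠ 0 → ∫ u, k x y u • c = 0) :
    ∫⁻ p : ℝ × ℝ, ‖∫ u, k p.1 p.2 u • f u‖ₑ ^ 2 ≤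
      poissonConst * ∫⁻ p, ‖diffQuot f p‖ₑ ^ 2 := by
  have hm := measurable_diffQuot hf
  have key : ∀ x y : ℝ, y ≠ 0 → ‖∫ u, k x y u • f u‖ₑ ≤
      ∫⁻ s : ℝ, ‖diffQuot f (x, x + s * y)‖ₑ * ENNReal.ofReal (|s| * (1 + s ^ 2)⁻¹) := by
    intro x y hy
    have e : ∫ u, k x y u • f u = ∫ u, k x y u • (f u - f x) := by
      simp only [smul_sub]
      rw [integral_sub (hi x y hy) (hc (f x) x y hy), h0 (f x) x y hy, sub_zero]
    -- The kernel has mean zero, so `f x` may be subtracted; one factor `|x - u|` comes from the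
    -- difference quotient.
    have hpt : ∀ u, ‖k x y u • (f u - f x)‖ₑ ≤
        ENNReal.ofReal (((x - u) ^ 2 + y ^ 2)⁻¹) * (‖x - u‖ₑ * ‖diffQuot f (x, u)‖ₑ) := by
      intro u
      rw [enorm_smul, enorm_sub_eq_mul_diffQuot, Real.enorm_eq_ofReal_abs]
      exact mul_le_mul_left (ENNReal.ofReal_le_ofReal (hk x y u)) _
    rw [e]
    refine (enorm_integral_le_lintegral_enorm _).trans ((lintegral_mono hpt).trans (le_of_eq ?_))
    have hsc := lintegral_comp_add_mul (g := fun u =>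
        ENNReal.ofReal (((x - u) ^ 2 + y ^ 2)⁻¹) * (‖x - u‖ₑ * ‖diffQuot f (x, u)‖ₑ))
      (by
        have : Measurable fun u => ‖diffQuot f (x, u)‖ₑ := (hm.comp measurable_prodMk_left).enorm
        fun_prop) x hy
    have hy1 : ENNReal.ofReal |y| * ENNReal.ofReal |y⁻¹| = 1 := by
      rw [← ENNReal.ofReal_mul (abs_nonneg y), ← abs_mul, mul_inv_cancel₀ hy]; simp
    rw [← one_mul (∫⁻ u, _), ← hy1, mul_assoc, ← hsc, ← lintegral_const_mul' _ _ (by simp)]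
    refine lintegral_congr fun s => ?_
    have e1 : x - (x + y * s) = -(y * s) := by ring
    rw [e1, Real.enorm_eq_ofReal_abs, mul_comm s y, ← mul_assoc, ← mul_assoc,
      ← ENNReal.ofReal_mul (by positivity), ← ENNReal.ofReal_mul (by positivity),
      mul_comm (ENNReal.ofReal _)]
    congr 2
    have h2 : (-(y * s)) ^ 2 + y ^ 2 = |y| ^ 2 * (1 + s ^ 2) := by rw [sq_abs]; ring
    have h3 : 1 + s ^ 2 ≠ 0 := by positivity
    have h4 := abs_ne_zero.2 hy
    rw [h2, abs_neg, abs_mul]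
    field_simp
  have hG : Measurable (Function.uncurry fun (p : ℝ × ℝ) (s : ℝ) =>
      ‖diffQuot f (p.1, p.1 + s * p.2)‖ₑ * ENNReal.ofReal (|s| * (1 + s ^ 2)⁻¹)) := by
    have h1 : Measurable fun q : (ℝ × ℝ) × ℝ => ‖diffQuot f (q.1.1, q.1.1 + q.2 * q.1.2)‖ₑ :=
      (hm.comp (by fun_prop)).enorm
    exact h1.mul (by fun_prop)
  have hae : ∀ᵐ p : ℝ × ℝ, p.2 ≠ 0 :=
    Measure.quasiMeasurePreserving_snd.ae (Measure.ae_ne volume 0)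
  refine (lintegral_mono_ae (hae.mono fun p hp => pow_le_pow_left' (key p.1 p.2 hp) 2)).trans ?_
  refine lintegral_sq_lintegral_le hG (by fun_prop) ?_
  filter_upwards [Measure.ae_ne volume 0] with s hs
  have hms : Measurable fun p : ℝ × ℝ => ‖diffQuot f (p.1, p.1 + s * p.2)‖ₑ ^ 2 :=
    (hm.comp (by fun_prop)).enorm.pow_const 2
  simp only [mul_pow]
  rw [lintegral_mul_const _ hms, Measure.volume_eq_prod, lintegral_prod _ hms.aemeasurable,
    lintegral_diffQuot_sq hf hs, mul_right_comm, ← ENNReal.ofReal_pow (by positivity),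
    ← ENNReal.ofReal_pow (by positivity), ← ENNReal.ofReal_mul (by positivity)]
  refine le_of_eq ?_
  congr 2
  have h1 : (|s| ^ (1 / 2 : ℝ)) ^ 2 = |s| := by
    rw [← Real.rpow_mul_natCast (abs_nonneg s)]; norm_num
  have h4 := abs_ne_zero.2 hs
  rw [mul_pow, mul_pow, h1, abs_inv]
  field_simp

/-! ### The Poisson integral has finite energy -/

/-- Integration by parts against a test function when the derivative is known off the point `0`. -/
theorem integral_deriv_smul_add_eq_zero {ψ ψ' : ℝ → ℝ} (h1 : ∀ t, HasDerivAt ψ (ψ' t) t)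
    (h2 : HasCompactSupport ψ) {w g : ℝ → ℂ} (hw : Continuous w)
    (hd : ∀ t, t ≠ 0 → HasDerivAt w (g t) t)
    (hi : Integrable fun t => ψ' t • w t + ψ t • g t) :
    ∫ t, (ψ' t • w t + ψ t • g t) = 0 := by
  obtain ⟨R, hR⟩ := h2.isCompact.isBounded.subset_ball 0
  have h0 : ∀ t, R ≤ |t| → t ∉ tsupport ψ := fun t ht hmem => by
    have := hR hmem
    rw [Metric.mem_ball, Real.dist_eq, sub_zero] at this
    linarith
  have hψ0 : ∀ t, R ≤ |t| → ψ t = 0 := fun t ht => image_eq_zero_of_notMem_tsupport (h0 t ht)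
  have hψ'0 : ∀ t, R ≤ |t| → ψ' t = 0 := fun t ht => by
    rw [← (h1 t).deriv]
    exact image_eq_zero_of_notMem_tsupport fun h => h0 t ht (tsupport_deriv_subset h)
  rcases le_or_gt R 0 with hR0 | hR0
  · have : ∀ t, ψ' t • w t + ψ t • g t = 0 := fun t => by
      rw [hψ0 t (hR0.trans (abs_nonneg t)), hψ'0 t (hR0.trans (abs_nonneg t))]; simp
    simp only [this, integral_zero]
  have hc : Continuous ψ := continuous_iff_continuousAt.2 fun t => (h1 t).continuousAt
  have key := MeasureTheory.integral_eq_of_hasDerivAt_off_countable_of_le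
    (fun t => ψ t • w t) (fun t => ψ' t • w t + ψ t • g t) (a := -R) (b := R) (by linarith)
    (countable_singleton 0) (hc.smul hw).continuousOn
    (fun t ht => by
      have := (h1 t).smul (hd t (by simpa using ht.2))
      rw [add_comm] at this
      exact this) hi.intervalIntegrable
  simp only [hψ0 R (le_abs_self R), hψ0 (-R) (by rw [abs_neg]; exact le_abs_self R), zero_smul,
    sub_zero] at key
  rw [← key, intervalIntegral.integral_of_le (by linarith)]
  refine (setIntegral_eq_integral_of_forall_compl_eq_zero fun t ht => ?_).symm
  have : R ≤ |t| := by
    by_contra h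
    rw [not_le, abs_lt] at h
    exact ht ⟨h.1, h.2.le⟩
  rw [hψ0 t this, hψ'0 t this]; simp

/-- A function that is absolutely continuous on almost every line parallel to the second axis has
its partial derivative as weak derivative; the partial derivative may be missing on the first
axis. -/
theorem isWeakDeriv_snd_of_ae_slice {F g : ℝ × ℝ → ℂ} (hF : LocallyIntegrable F)
    (hg : LocallyIntegrable g)
    (h : ∀ᵐ x, ∃ w : ℝ → ℂ, Continuous w ∧ (∀ y, y ≠ 0 → w y = F (x, y)) ∧
      ∀ y, y ≠ 0 → HasDerivAt w (g (x, y)) y) : IsWeakDeriv (0, 1) F g := by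
  intro φ h1 h2
  have i1 := integrable_deriv_smul hF h1 h2 (0, 1)
  have i2 := integrable_test_smul hg h1.continuous h2
  have i3 : Integrable fun p => (fderiv ℝ φ p (0, 1)) • F p + φ p • g p := i1.add i2
  rw [eq_neg_iff_add_eq_zero, ← integral_add i1 i2, Measure.volume_eq_prod,
    integral_prod _ i3]
  refine integral_eq_zero_of_ae ?_
  filter_upwards [h, i3.prod_right_ae] with x ⟨w, hw, hwF, hwd⟩ hix
  have e : (fun y => (fderiv ℝ φ (x, y) (0, 1)) • F (x, y) + φ (x, y) • g (x, y)) =ᵐ[volume]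
      fun y => (fderiv ℝ φ (x, y) (0, 1)) • w y + φ (x, y) • g (x, y) := by
    filter_upwards [Measure.ae_ne volume (0 : ℝ)] with y hy
    rw [hwF y hy]
  refine (integral_congr_ae e).trans ?_
  refine integral_deriv_smul_add_eq_zero (fun y => ?_) ?_ hw hwd (Integrable.congr hix e)
  · exact ((h1.differentiable (by simp) (x, y)).hasFDerivAt).comp_hasDerivAt y
      ((hasDerivAt_const y x).prodMk (hasDerivAt_id y))
  · exact h2.comp_isClosedEmbedding
      (Isometry.of_dist_eq fun a b => by simp [Prod.dist_eq]).isClosedEmbedding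

theorem isWeakDeriv_fst_of_ae_slice {F g : ℝ × ℝ → ℂ} (hF : LocallyIntegrable F)
    (hg : LocallyIntegrable g)
    (h : ∀ᵐ y, ∀ x, HasDerivAt (fun x => F (x, y)) (g (x, y)) x) : IsWeakDeriv (1, 0) F g := by
  intro φ h1 h2
  have i1 := integrable_deriv_smul hF h1 h2 (1, 0)
  have i2 := integrable_test_smul hg h1.continuous h2
  have i3 : Integrable fun p => (fderiv ℝ φ p (1, 0)) • F p + φ p • g p := i1.add i2
  rw [eq_neg_iff_add_eq_zero, ← integral_add i1 i2, Measure.volume_eq_prod,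
    integral_prod_symm _ i3]
  refine integral_eq_zero_of_ae ?_
  filter_upwards [h, i3.prod_left_ae] with y hy hiy
  refine integral_deriv_smul_add_eq_zero (fun x => ?_) ?_
    (continuous_iff_continuousAt.2 fun x => (hy x).continuousAt) (fun x _ => hy x) hiy
  · exact ((h1.differentiable (by simp) (x, y)).hasFDerivAt).comp_hasDerivAt x
      ((hasDerivAt_id x).prodMk (hasDerivAt_const x y))
  · exact h2.comp_isClosedEmbedding
      (Isometry.of_dist_eq fun a b => by simp [Prod.dist_eq]).isClosedEmbedding

theorem stronglyMeasurable_integral_smul {f : ℝ → ℂ} (hf : Measurable f)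
    {k : ℝ → ℝ → ℝ → ℝ} (hk : Measurable fun q : (ℝ × ℝ) × ℝ => k q.1.1 q.1.2 q.2) :
    StronglyMeasurable fun p : ℝ × ℝ => ∫ u, k p.1 p.2 u • f u := by
  have : StronglyMeasurable fun q : (ℝ × ℝ) × ℝ => k q.1.1 q.1.2 q.2 • f q.2 :=
    (hk.smul (hf.comp measurable_snd)).stronglyMeasurable
  exact this.integral_prod_right'

/-- Over a bounded interval, the slices of `Ef` differ from `f` by a bounded amount in `L²`. -/
theorem locallyIntegrable_poissonExtension {f : ℝ → ℂ} (hf : Measurable f)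
    (hh : f ∈ halfFunctions) : LocallyIntegrable (poissonExtension f) := by
  have hi := poissonIntegrable_of_mem_halfFunctions hh
  have hE : poissonExtension f = fun p => ∫ u, poissonKer p.1 p.2 u • f u :=
    funext fun p => poissonExtension_eq f p.1 p.2
  have hsm : StronglyMeasurable (poissonExtension f) := by
    rw [hE]; exact stronglyMeasurable_integral_smul hf measurable_poissonKer
  have hQ : ∫⁻ p, ‖diffQuot f p‖ₑ ^ 2 < ⊤ := hh.2.lintegral_enorm_sq_lt_top
  refine locallyIntegrable_iff.2 fun K hK => ?_
  obtain ⟨R, hR⟩ := hK.isBounded.subset_closedBall 0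
  have hsub : K ⊆ Icc (-R) R ×ˢ Icc (-R) R := by
    refine hR.trans fun p hp => ?_
    rw [Metric.mem_closedBall, dist_zero_right, Prod.norm_def, max_le_iff] at hp
    exact ⟨abs_le.1 hp.1, abs_le.1 hp.2⟩
  refine IntegrableOn.mono_set ?_ hsub
  have hfin : volume (Icc (-R) R ×ˢ Icc (-R) R : Set (ℝ × ℝ)) < ⊤ :=
    (isCompact_Icc.prod isCompact_Icc).measure_lt_top
  have : IsFiniteMeasure (volume.restrict (Icc (-R) R ×ˢ Icc (-R) R : Set (ℝ × ℝ))) :=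
    ⟨by simpa using hfin⟩
  refine (memLp_two_of_lintegral_lt_top hsm.aestronglyMeasurable.restrict ?_).integrable
    (by norm_num)
  set I : Set ℝ := Icc (-R) R
  have hfI : ∫⁻ x in I, ‖f x‖ₑ ^ 2 < ⊤ := (hh.1 I isCompact_Icc).lintegral_enorm_sq_lt_top
  have hm2 : Measurable fun p => ‖poissonExtension f p‖ₑ ^ 2 := hsm.measurable.enorm.pow_const 2
  rw [Measure.volume_eq_prod, ← Measure.prod_restrict, lintegral_prod_symm' _ hm2]
  have hle : ∀ᵐ y ∂(volume.restrict I), ∫⁻ x in I, ‖poissonExtension f (x, y)‖ₑ ^ 2 ≤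
      2 * (ENNReal.ofReal R * ∫⁻ p, ‖diffQuot f p‖ₑ ^ 2) + 2 * ∫⁻ x in I, ‖f x‖ₑ ^ 2 := by
    filter_upwards [ae_restrict_mem measurableSet_Icc,
      ae_restrict_of_ae (Measure.ae_ne volume (0 : ℝ))] with y hyI hy
    have hy2 : ‖y‖ₑ ≤ ENNReal.ofReal R := by
      rw [Real.enorm_eq_ofReal_abs]; exact ENNReal.ofReal_le_ofReal (abs_le.2 hyI)
    calc ∫⁻ x in I, ‖poissonExtension f (x, y)‖ₑ ^ 2
        ≤ ∫⁻ x in I, (2 * ‖poissonExtension f (x, y) - f x‖ₑ ^ 2 + 2 * ‖f x‖ₑ ^ 2) := by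
          refine lintegral_mono fun x => ?_
          refine le_trans (pow_le_pow_left' ?_ 2) (ENNReal.add_sq_le_two_mul _ _)
          simpa using enorm_add_le (poissonExtension f (x, y) - f x) (f x)
      _ = 2 * (∫⁻ x in I, ‖poissonExtension f (x, y) - f x‖ₑ ^ 2)
            + 2 * ∫⁻ x in I, ‖f x‖ₑ ^ 2 := by
          rw [lintegral_add_right _ (by fun_prop), lintegral_const_mul' _ _ (by simp),
            lintegral_const_mul' _ _ (by simp)]
      _ ≤ _ := by
          refine add_le_add_left (mul_le_mul_right ((setLIntegral_le_lintegral _ _).trans ?_) 2) _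
          exact (lintegral_poissonExtension_sub_sq_le hf hi hy).trans (mul_le_mul_left hy2 _)
  refine (lintegral_mono_ae hle).trans_lt ?_
  rw [lintegral_const]
  refine ENNReal.mul_lt_top (ENNReal.add_lt_top.2 ⟨?_, ?_⟩) ?_
  · exact ENNReal.mul_lt_top (by simp) (ENNReal.mul_lt_top (by simp) hQ)
  · exact ENNReal.mul_lt_top (by simp) hfI
  · simp [I]

/-- For almost every `x` the function equal to `Ef(x, y)` for `y ≠ 0` and to `f(x)` for `y = 0` is
continuous in `y`. -/
theorem continuous_update_poissonExtension {f : ℝ → ℂ} (hf : Measurable f)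
    (hi : PoissonIntegrable f) {x : ℝ} (hx : MemLp (fun u => diffQuot f (x, u)) 2 volume) :
    Continuous (Function.update (fun y => poissonExtension f (x, y)) 0 (f x)) := by
  refine continuous_iff_continuousAt.2 fun y => ?_
  rcases eq_or_ne y 0 with rfl | hy
  · rw [continuousAt_update_same, tendsto_iff_edist_tendsto_0]
    have hlim : Tendsto (fun y : ℝ => (‖y‖ₑ * ∫⁻ u, ‖diffQuot f (x, u)‖ₑ ^ 2) ^ (1 / 2 : ℝ))
        (𝓝[≠] 0) (𝓝 0) := by
      have h2 := (tendsto_enorm_mul_const hx.lintegral_enorm_sq_lt_top.ne).ennrpow_const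
        (1 / 2 : ℝ)
      rw [ENNReal.zero_rpow_of_pos (by norm_num)] at h2
      exact h2.mono_left nhdsWithin_le_nhds
    refine tendsto_of_tendsto_of_tendsto_of_le_of_le' tendsto_const_nhds hlim
      (Eventually.of_forall fun _ => zero_le) ?_
    filter_upwards [self_mem_nhdsWithin] with y hy
    have := enorm_poissonExtension_sub_sq_le hf hi x hy
    rw [edist_eq_enorm_sub, one_div, ENNReal.le_rpow_inv_iff (by norm_num)]
    simpa using this
  · rw [continuousAt_update_of_ne hy]
    have := (hi.hasDerivAt_y x hy).2.continuousAt
    simpa only [poissonExtension_eq] using this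

/-- The Poisson integral of a function in `H^{1/2}` has finite energy. -/
theorem exists_isWeakGrad_poissonExtension {f : ℝ → ℂ} (hf : Measurable f)
    (hh : f ∈ halfFunctions) :
    ∃ G : L2Field, IsWeakGrad (poissonExtension f) G ∧
      (∫⁻ p, ‖G.fst p‖ₑ ^ 2) + ∫⁻ p, ‖G.snd p‖ₑ ^ 2 ≤
        2 * poissonConst * ∫⁻ p, ‖diffQuot f p‖ₑ ^ 2 := by
  have hi := poissonIntegrable_of_mem_halfFunctions hh
  have hQ : ∫⁻ p, ‖diffQuot f p‖ₑ ^ 2 < ⊤ := hh.2.lintegral_enorm_sq_lt_top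
  have b1 := lintegral_enorm_integral_sq_le hf abs_poissonKerDx_le
    (fun x y hy => (hi.hasDerivAt_x x hy).1)
    (fun c x y hy => ((PoissonIntegrable.const c).hasDerivAt_x x hy).1)
    (fun c x y hy => integral_poissonKerDx_smul_const c x hy)
  have b2 := lintegral_enorm_integral_sq_le hf abs_poissonKerDy_le
    (fun x y hy => (hi.hasDerivAt_y x hy).1)
    (fun c x y hy => ((PoissonIntegrable.const c).hasDerivAt_y x hy).1)
    (fun c x y hy => integral_poissonKerDy_smul_const c x hy)
  have l1 := memLp_two_of_lintegral_lt_top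
    (stronglyMeasurable_integral_smul hf measurable_poissonKerDx).aestronglyMeasurable
    (b1.trans_lt (ENNReal.mul_lt_top poissonConst_lt_top hQ))
  have l2 := memLp_two_of_lintegral_lt_top
    (stronglyMeasurable_integral_smul hf measurable_poissonKerDy).aestronglyMeasurable
    (b2.trans_lt (ENNReal.mul_lt_top poissonConst_lt_top hQ))
  have hloc := locallyIntegrable_poissonExtension hf hh
  have w1 : IsWeakDeriv (1, 0) (poissonExtension f)
      fun p => ∫ u, poissonKerDx p.1 p.2 u • f u := by
    refine isWeakDeriv_fst_of_ae_slice hloc (l1.locallyIntegrable (by norm_num)) ?_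
    filter_upwards [Measure.ae_ne volume (0 : ℝ)] with y hy x
    simpa only [poissonExtension_eq] using (hi.hasDerivAt_x x hy).2
  have w2 : IsWeakDeriv (0, 1) (poissonExtension f)
      fun p => ∫ u, poissonKerDy p.1 p.2 u • f u := by
    refine isWeakDeriv_snd_of_ae_slice hloc (l2.locallyIntegrable (by norm_num)) ?_
    filter_upwards [ae_memLp_diffQuot hh] with x hx
    refine ⟨_, continuous_update_poissonExtension hf hi hx,
      fun y hy => Function.update_of_ne hy _ _, fun y hy => ?_⟩
    refine ((hi.hasDerivAt_y x hy).2).congr_of_eventuallyEq ?_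
    filter_upwards [isOpen_ne.mem_nhds hy] with z hz
    rw [Function.update_of_ne hz, poissonExtension_eq]
  refine ⟨WithLp.toLp 2 (l1.toLp _, l2.toLp _), ⟨fun φ h1 h2 => ?_, fun φ h1 h2 => ?_⟩, ?_⟩
  · rw [w1 φ h1 h2]
    congr 1
    refine integral_congr_ae (l1.coeFn_toLp.mono fun p hp => ?_)
    simp only [WithLp.toLp_fst, hp]
  · rw [w2 φ h1 h2]
    congr 1
    refine integral_congr_ae (l2.coeFn_toLp.mono fun p hp => ?_)
    simp only [WithLp.toLp_snd, hp]
  · have e1 : ∫⁻ p, ‖l1.toLp _ p‖ₑ ^ 2 ≤ _ :=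
      (lintegral_congr_ae (l1.coeFn_toLp.mono fun p hp => by simp only [hp])).trans_le b1
    have e2 : ∫⁻ p, ‖l2.toLp _ p‖ₑ ^ 2 ≤ _ :=
      (lintegral_congr_ae (l2.coeFn_toLp.mono fun p hp => by simp only [hp])).trans_le b2
    rw [mul_assoc, two_mul]
    exact add_le_add e1 e2

/-! ### The trace and the extension on classes modulo constants -/

theorem H1.ofReal_norm_mk_sq (F : energyFunctions) :
    ENNReal.ofReal (‖H1.mk F‖ ^ 2) =
      (∫⁻ p, ‖(weakGrad F).fst p‖ₑ ^ 2) + ∫⁻ p, ‖(weakGrad F).snd p‖ₑ ^ 2 := by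
  have : ‖H1.mk F‖ ^ 2 = ‖(weakGrad F).fst‖ ^ 2 + ‖(weakGrad F).snd‖ ^ 2 :=
    WithLp.prod_norm_sq_eq_of_L2 (weakGrad F)
  rw [this, ENNReal.ofReal_add (sq_nonneg _) (sq_nonneg _), ofReal_norm_sq_eq_lintegral,
    ofReal_norm_sq_eq_lintegral]

theorem Hhalf.ofReal_norm_mk_sq (f : halfFunctions) :
    ENNReal.ofReal (‖Hhalf.mk f‖ ^ 2) = ∫⁻ p, ‖diffQuot f p‖ₑ ^ 2 := by
  have h : ‖Hhalf.mk f‖ ^ 2 = ‖diffQuotL2 f‖ ^ 2 := rfl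
  rw [h, ofReal_norm_sq_eq_lintegral]
  refine lintegral_congr_ae ((MemLp.coeFn_toLp f.2.2).mono fun p hp => ?_)
  have h' : diffQuotL2 f p = diffQuot f p := hp
  simp only [h']

theorem Hhalf.mk_eq_of_ae_eq {f g : halfFunctions} (h : (f : ℝ → ℂ) =ᵐ[volume] g) :
    Hhalf.mk f = Hhalf.mk g := by
  refine (Submodule.Quotient.eq halfConstants).2 ⟨0, ?_⟩
  filter_upwards [h] with x hx
  simp [hx]

theorem exists_trace_mem (F : energyFunctions) :
    ∃ f : halfFunctions, IsTrace F f ∧ ∫⁻ p, ‖diffQuot f p‖ₑ ^ 2 ≤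
      64 * ((∫⁻ p, ‖(weakGrad F).fst p‖ₑ ^ 2) + ∫⁻ p, ‖(weakGrad F).snd p‖ₑ ^ 2) := by
  obtain ⟨f, hf, hb⟩ := exists_trace F.2.1 (isWeakGrad_weakGrad F)
  refine ⟨⟨f, mem_halfFunctions hf.1 (hb.trans_lt ?_)⟩, hf, hb⟩
  rw [← H1.ofReal_norm_mk_sq]
  exact ENNReal.mul_lt_top (by simp) ENNReal.ofReal_lt_top

/-- A representative of the trace of a function of finite energy. -/
noncomputable def traceFun (F : energyFunctions) : halfFunctions := (exists_trace_mem F).choose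

theorem isTrace_traceFun (F : energyFunctions) : IsTrace F (traceFun F) :=
  (exists_trace_mem F).choose_spec.1

theorem mk_traceFun_eq {F : energyFunctions} {f : halfFunctions} (h : IsTrace F f) :
    Hhalf.mk (traceFun F) = Hhalf.mk f :=
  Hhalf.mk_eq_of_ae_eq ((isTrace_traceFun F).ae_eq F.2.1.aestronglyMeasurable h)

/-- The trace as a linear map with values in the classes modulo constants. -/
noncomputable def traceLin : energyFunctions →ₗ[ℂ] Hhalf where
  toFun F := Hhalf.mk (traceFun F)
  map_add' F F' := by
    rw [← map_add]
    exact mk_traceFun_eq ((isTrace_traceFun F).add F.2.1.aestronglyMeasurable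
      (isTrace_traceFun F'))
  map_smul' a F := by
    rw [RingHom.id_apply, ← map_smul]
    exact mk_traceFun_eq ((isTrace_traceFun F).const_smul a)

theorem norm_traceLin_le (F : energyFunctions) : ‖traceLin F‖ ≤ 8 * ‖H1.mk F‖ := by
  have h := (exists_trace_mem F).choose_spec.2
  have h' : ENNReal.ofReal (‖traceLin F‖ ^ 2) ≤ ENNReal.ofReal (64 * ‖H1.mk F‖ ^ 2) := by
    rw [ENNReal.ofReal_mul (by norm_num), H1.ofReal_norm_mk_sq]
    refine (Hhalf.ofReal_norm_mk_sq (traceFun F)).trans_le (h.trans (le_of_eq ?_))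
    norm_num
  rw [ENNReal.ofReal_le_ofReal_iff (by positivity)] at h'
  refine le_of_sq_le_sq ?_ (by positivity)
  linarith [mul_pow 8 ‖H1.mk F‖ 2]

theorem energyConstants_le_ker_traceLin : energyConstants ≤ LinearMap.ker traceLin := by
  intro F hF
  have h0 : H1.mk F = 0 := (Submodule.Quotient.mk_eq_zero _).2 hF
  have := norm_traceLin_le F
  rw [h0, norm_zero, mul_zero] at this
  exact LinearMap.mem_ker.2 (norm_le_zero_iff.1 this)

/-- The trace operator `H¹(ℝ²) → H^{1/2}(ℝ)`. -/
noncomputable def traceCLM : H1 →L[ℂ] Hhalf :=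
  LinearMap.mkContinuous
    (energyConstants.liftQ traceLin energyConstants_le_ker_traceLin : H1 →ₗ[ℂ] Hhalf) 8 (by
    intro u
    obtain ⟨F, rfl⟩ := Submodule.mkQ_surjective energyConstants u
    exact norm_traceLin_le F)

theorem traceCLM_mk (F : energyFunctions) : traceCLM (H1.mk F) = Hhalf.mk (traceFun F) := rfl

/-- The properties of the Poisson integral hold for every function in `H^{1/2}`, by passing to a
Borel measurable representative, which does not change the Poisson integral at any point. -/
theorem poissonExtension_properties (f : halfFunctions) :
    LocallyIntegrable (poissonExtension f) ∧ IsTrace (poissonExtension f) f ∧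
    ∃ G : L2Field, IsWeakGrad (poissonExtension f) G ∧
      (∫⁻ p, ‖G.fst p‖ₑ ^ 2) + ∫⁻ p, ‖G.snd p‖ₑ ^ 2 ≤
        2 * poissonConst * ∫⁻ p, ‖diffQuot f p‖ₑ ^ 2 := by
  have hm := (aestronglyMeasurable_of_mem_halfFunctions f.2).aemeasurable
  have hae : (f : ℝ → ℂ) =ᵐ[volume] hm.mk f := hm.ae_eq_mk
  have hdq : ∫⁻ p, ‖diffQuot f p‖ₑ ^ 2 = ∫⁻ p, ‖diffQuot (hm.mk f) p‖ₑ ^ 2 :=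
    lintegral_congr_ae ((diffQuot_ae_eq hae).mono fun p hp => by simp only [hp])
  have hP : poissonExtension f = poissonExtension (hm.mk f) := by
    ext p
    rw [poissonExtension_eq (f : ℝ → ℂ) p.1 p.2, poissonExtension_eq (hm.mk f) p.1 p.2]
    exact integral_congr_ae (hae.mono fun u hu => by simp only [hu])
  have hh : hm.mk f ∈ halfFunctions := by
    refine mem_halfFunctions hm.measurable_mk.aestronglyMeasurable ?_
    rw [← hdq]
    exact f.2.2.lintegral_enorm_sq_lt_top
  have hQ : ∫⁻ p, ‖diffQuot f p‖ₑ ^ 2 ≠ ⊤ := f.2.2.lintegral_enorm_sq_lt_top.ne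
  have hi := poissonIntegrable_of_mem_halfFunctions hh
  rw [hP, hdq]
  refine ⟨locallyIntegrable_poissonExtension hm.measurable_mk hh, IsTrace.congr ?_ hae,
    exists_isWeakGrad_poissonExtension hm.measurable_mk hh⟩
  refine isTrace_of_ae_le hm.measurable_mk.aestronglyMeasurable (hdq ▸ hQ) ?_
  filter_upwards [Measure.ae_ne volume (0 : ℝ)] with y hy
  exact lintegral_poissonExtension_sub_sq_le hm.measurable_mk hi hy

/-- The Poisson integral as a function of finite energy. -/
noncomputable def extensionFun (f : halfFunctions) : energyFunctions :=
  ⟨poissonExtension f, (poissonExtension_properties f).1,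
    (poissonExtension_properties f).2.2.imp fun _ h => h.1⟩

theorem norm_mk_extensionFun_le (f : halfFunctions) :
    ‖H1.mk (extensionFun f)‖ ≤ √(2 * poissonConst.toReal) * ‖Hhalf.mk f‖ := by
  obtain ⟨G, hG, hb⟩ := (poissonExtension_properties f).2.2
  have hGe : weakGrad (extensionFun f) = G := (isWeakGrad_weakGrad (extensionFun f)).unique hG
  have h' : ENNReal.ofReal (‖H1.mk (extensionFun f)‖ ^ 2) ≤
      ENNReal.ofReal (2 * poissonConst.toReal * ‖Hhalf.mk f‖ ^ 2) := by
    rw [ENNReal.ofReal_mul (by positivity), ENNReal.ofReal_mul (by norm_num),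
      ENNReal.ofReal_toReal poissonConst_lt_top.ne, H1.ofReal_norm_mk_sq,
      Hhalf.ofReal_norm_mk_sq, hGe]
    refine hb.trans (le_of_eq ?_)
    norm_num
  rw [ENNReal.ofReal_le_ofReal_iff (by positivity)] at h'
  refine le_of_sq_le_sq ?_ (by positivity)
  rwa [mul_pow, Real.sq_sqrt (by positivity)]

theorem integrable_poisson (f : halfFunctions) (x : ℝ) {y : ℝ} (hy : y ≠ 0) :
    Integrable fun t : ℝ => (f : ℝ → ℂ) (x - t) / ((t ^ 2 + y ^ 2 : ℝ) : ℂ) := by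
  have h := ((poissonIntegrable_of_mem_halfFunctions f.2).integrable_poissonKer x
    hy).comp_sub_left x
  refine (h.const_mul (((Real.pi / |y| : ℝ)) : ℂ)).congr (ae_of_all _ fun t => ?_)
  have h1 : |y| ≠ 0 := abs_ne_zero.2 hy
  have h2 := (sq_add_sq_pos t hy).ne'
  have h3 := Real.pi_ne_zero
  have h4 : Real.pi / |y| * poissonKer x y (x - t) = (t ^ 2 + y ^ 2)⁻¹ := by
    rw [poissonKer, sub_sub_cancel]
    field_simp
  simp only [Complex.real_smul]
  rw [← mul_assoc, ← Complex.ofReal_mul, h4, Complex.ofReal_inv, div_eq_mul_inv, mul_comm]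

theorem extensionFun_add (f g : halfFunctions) :
    extensionFun (f + g) = extensionFun f + extensionFun g := by
  refine Subtype.ext (funext fun p => ?_)
  change poissonExtension (f + g : halfFunctions) p = poissonExtension f p + poissonExtension g p
  rcases eq_or_ne p.2 0 with h | h
  · simp [poissonExtension, h]
  · simp only [poissonExtension, Submodule.coe_add, Pi.add_apply, add_div]
    rw [integral_add (integrable_poisson f p.1 h) (integrable_poisson g p.1 h), mul_add]

theorem extensionFun_smul (a : ℂ) (f : halfFunctions) :
    extensionFun (a • f) = a • extensionFun f := by
  refine Subtype.ext (funext fun p => ?_)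
  change poissonExtension (a • f : halfFunctions) p = a * poissonExtension f p
  simp only [poissonExtension, Submodule.coe_smul, Pi.smul_apply, smul_eq_mul, mul_div_assoc]
  rw [integral_const_mul, mul_left_comm]

/-- The Poisson integral as a linear map with values in the classes modulo constants. -/
noncomputable def extensionLin : halfFunctions →ₗ[ℂ] H1 where
  toFun f := H1.mk (extensionFun f)
  map_add' f g := by rw [extensionFun_add, map_add]
  map_smul' a f := by rw [extensionFun_smul, map_smul, RingHom.id_apply]

theorem halfConstants_le_ker_extensionLin : halfConstants ≤ LinearMap.ker extensionLin := by
  intro f hf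
  have h0 : Hhalf.mk f = 0 := (Submodule.Quotient.mk_eq_zero _).2 hf
  have := norm_mk_extensionFun_le f
  rw [h0, norm_zero, mul_zero] at this
  exact LinearMap.mem_ker.2 (norm_le_zero_iff.1 this)

/-- The extension operator `H^{1/2}(ℝ) → H¹(ℝ²)` given by the Poisson integral. -/
noncomputable def extensionCLM : Hhalf →L[ℂ] H1 :=
  LinearMap.mkContinuous
    (halfConstants.liftQ extensionLin halfConstants_le_ker_extensionLin : Hhalf →ₗ[ℂ] H1)
    √(2 * poissonConst.toReal) (by
    intro u
    obtain ⟨f, rfl⟩ := Submodule.mkQ_surjective halfConstants u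
    exact norm_mk_extensionFun_le f)

theorem extensionCLM_mk (f : halfFunctions) :
    extensionCLM (Hhalf.mk f) = H1.mk (extensionFun f) := rfl

theorem isTrace_iff_ae_eq_traceFun (F : energyFunctions) (g : ℝ → ℂ) :
    IsTrace F g ↔ g =ᵐ[volume] traceFun F :=
  ⟨fun h => h.ae_eq F.2.1.aestronglyMeasurable (isTrace_traceFun F),
    fun h => (isTrace_traceFun F).congr h⟩

theorem theorem3p1 :
    ∃ (T : H1 →L[ℂ] Hhalf) (E : Hhalf →L[ℂ] H1) (c : ℝ), 0 < c ∧
      (∀ F : energyFunctions, ∃ f : halfFunctions, T (H1.mk F) = Hhalf.mk f ∧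
        ∀ g : ℝ → ℂ, IsTrace F g ↔ g =ᵐ[volume] f) ∧
      (∀ F : energyFunctions, Continuous (F : ℝ × ℝ → ℂ) →
        ∃ f : halfFunctions, (∀ x, (f : ℝ → ℂ) x = (F : ℝ × ℝ → ℂ) (x, 0)) ∧
          T (H1.mk F) = Hhalf.mk f) ∧
      (∀ u : H1, ‖T u‖ ≤ c * ‖u‖) ∧
      (∀ f : halfFunctions,
        (∀ x y : ℝ, y ≠ 0 →
          Integrable fun t : ℝ => (f : ℝ → ℂ) (x - t) / ((t ^ 2 + y ^ 2 : ℝ) : ℂ)) ∧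
        ∃ F : energyFunctions, (F : ℝ × ℝ → ℂ) = poissonExtension f ∧
          E (Hhalf.mk f) = H1.mk F ∧ IsTrace F f) ∧
      (∀ u : Hhalf, T (E u) = u) ∧
      (∀ u : Hhalf, ‖E u‖ ≤ c * ‖u‖) := by
  have hs := Real.sqrt_nonneg (2 * poissonConst.toReal)
  refine ⟨traceCLM, extensionCLM, 8 + √(2 * poissonConst.toReal), by linarith,
    fun F => ⟨traceFun F, traceCLM_mk F, isTrace_iff_ae_eq_traceFun F⟩, fun F hF => ?_, fun u => ?_,
    fun f => ⟨fun x y hy => integrable_poisson f x hy, extensionFun f, rfl, extensionCLM_mk f,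
      (poissonExtension_properties f).2.1⟩, fun u => ?_, fun u => ?_⟩
  · have ht := isTrace_of_continuous hF
    have hae := (isTrace_iff_ae_eq_traceFun F _).1 ht
    have hmem : (fun x => (F : ℝ × ℝ → ℂ) (x, 0)) ∈ halfFunctions := by
      refine mem_halfFunctions ht.1 (lt_of_eq_of_lt ?_ (traceFun F).2.2.lintegral_enorm_sq_lt_top)
      exact lintegral_congr_ae ((diffQuot_ae_eq hae).mono fun p hp => by simp only [hp])
    exact ⟨⟨_, hmem⟩, fun x => rfl, mk_traceFun_eq (f := ⟨_, hmem⟩) ht⟩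
  · obtain ⟨F, rfl⟩ := Submodule.mkQ_surjective energyConstants u
    refine (norm_traceLin_le F).trans ?_
    exact mul_le_mul_of_nonneg_right (by linarith) (norm_nonneg _)
  · obtain ⟨f, rfl⟩ := Submodule.mkQ_surjective halfConstants u
    exact mk_traceFun_eq (F := extensionFun f) (poissonExtension_properties f).2.1
  · obtain ⟨f, rfl⟩ := Submodule.mkQ_surjective halfConstants u
    refine (norm_mk_extensionFun_le f).trans ?_
    exact mul_le_mul_of_nonneg_right (by linarith) (norm_nonneg _)
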